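/- Work over $\mathbb{C}$. Let $C\subset\mathbb{P}^2$ be a reduced plane curve and $P\in C$ a double point (a point of multiplicity $2$). For $s\ge 1$, say that $P$ is an $A_s$ singularity of $C$ if, writing $s=2r-\varepsilon$ with $\varepsilon\in\{0,1\}$, it is resolved by $r$ blow-ups (of $P$ and then of the singular points of the successive strict transforms lying above $P$), and the resulting desingularization has two points above $P$ if $\varepsilon=1$ and only one if $\varepsilon=0$. A curvilinear scheme supported at $P$ is a $0$-dimensional subscheme of $\mathbb{P}^2$ whose only point is $P$ and which is contained in some curve smooth at $P$. Then: (0) for every $r\ge 1$, no curvilinear scheme supported at $P$ of length $>2r+1$ is contained in $C$ if and only if $P$ is an $A_{2s}$ singularity of $C$ for some $s$ with $1\le s\le r$; (i) $P$ is an $A_{2r-1}$ singularity of $C$ for some $r\ge 1$ if and only if for every $\ell\ge 1$ there is a curvilinear scheme supported at $P$ of length $\ell$ contained in $C$; (ii) for every $r\ge 1$, $P$ is an $A_{2r}$ singularity of $C$ if and only if for every $\ell$ with $1\le\ell\le 2r+1$ there is a curvilinear scheme supported at $P$ of length $\ell$ contained in $C$, and no curvilinear scheme supported at $P$ of length $>2r+1$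 is contained in $C$. -/

import Mathlib

/-- The equation, in the affine chart `z = 1`, of the projective plane curve `F = 0` with respect
to the homogeneous coordinates `[x : y : z]` attached to a basis `e` of `ℂ³`: it is
`F (x • e₀ + y • e₁ + e₂)`. The point `[e₂]` is the origin of the chart. -/
noncomputable def localEquation (F : MvPolynomial (Fin 3) ℂ)
    (e : Module.Basis (Fin 3) ℂ (Fin 3 → ℂ)) : MvPolynomial (Fin 2) ℂ :=
  MvPolynomial.aeval (fun i : Fin 3 =>
    MvPolynomial.C (e 0 i) * MvPolynomial.X 0 + MvPolynomial.C (e 1 i) * MvPolynomial.X 1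
      + MvPolynomial.C (e 2 i)) F

/-- The multiplicity at the origin of the curve `f = 0`: the least total degree of a monomial
of `f` (and `⊤` for `f = 0`). The origin lies on the curve iff it is positive, is a smooth point
iff it is `1`, and is a double point iff it is `2`. -/
noncomputable def multAtOrigin (f : MvPolynomial (Fin 2) ℂ) : ℕ∞ :=
  MvPowerSeries.order (f : MvPowerSeries (Fin 2) ℂ)

/-- The strict transform of the curve `f = 0` under the blow-up of the plane at the origin, near
the point of the exceptional line given by the slope `q ∈ ℂ ∪ {∞}`, in coordinates centred at that
point: `f (x, x (y + t)) / x ^ m` if `q = t` is finite, `f (x y, y) / y ^ m` if `q = ∞`, where `m`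
is the multiplicity of `f = 0` at the origin. -/
noncomputable def strictTransform (f : MvPolynomial (Fin 2) ℂ) :
    OnePoint ℂ → MvPolynomial (Fin 2) ℂ
  | OnePoint.infty =>
      MvPolynomial.divMonomial
        (MvPolynomial.aeval ![MvPolynomial.X 0 * MvPolynomial.X 1, MvPolynomial.X 1] f)
        (Finsupp.single 1 (multAtOrigin f).toNat)
  | OnePoint.some t =>
      MvPolynomial.divMonomial
        (MvPolynomial.aeval ![MvPolynomial.X 0,
          MvPolynomial.X 0 * (MvPolynomial.X 1 + MvPolynomial.C t)] f)
        (Finsupp.single 0 (multAtOrigin f).toNat)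

/-- `ResolvedBy f r k`: blowing up the origin if it is a singular point of `f = 0`, then the
singular points of the strict transform above it, and so on, one reaches a curve that is smooth at
all its points above the origin; this takes `r` blow-ups, and there are then `k` points above
the origin. -/
inductive ResolvedBy : MvPolynomial (Fin 2) ℂ → ℕ → ℕ → Prop
  | smooth (f : MvPolynomial (Fin 2) ℂ) (hf : multAtOrigin f = 1) : ResolvedBy f 0 1
  | blowUp (f : MvPolynomial (Fin 2) ℂ) (hf : 2 ≤ multAtOrigin f)
      (S : Finset (OnePoint ℂ))
      (hS : ∀ q, q ∈ S ↔ MvPolynomial.constantCoeff (strictTransform f q) = 0)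
      (r k : OnePoint ℂ → ℕ)
      (hq : ∀ q ∈ S, ResolvedBy (strictTransform f q) (r q) (k q)) :
      ResolvedBy f (1 + ∑ q ∈ S, r q) (∑ q ∈ S, k q)

/-- The origin is a singularity of type `A_s` of `f = 0`: a double point that is resolved by `r`
blow-ups, where `s = 2 r - ε` with `ε ∈ {0, 1}`, and the desingularization has two points above it
if `ε = 1` and only one if `ε = 0`. -/
def IsTypeA (f : MvPolynomial (Fin 2) ℂ) (s : ℕ) : Prop :=
  multAtOrigin f = 2 ∧ ∃ r ε : ℕ, ε ≤ 1 ∧ s + ε = 2 * r ∧ ResolvedBy f r (1 + ε)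

/-- The closed subscheme of the affine plane with ideal `I` is a curvilinear zero-dimensional scheme
of length `ℓ` supported at the origin: its only point is the origin, its coordinate ring has
dimension `ℓ` over `ℂ`, and it is contained in a curve `g = 0` smooth at the origin. -/
def IsCurvilinearAtOrigin (I : Ideal (MvPolynomial (Fin 2) ℂ)) (ℓ : ℕ) : Prop :=
  I.radical = Ideal.span {MvPolynomial.X 0, MvPolynomial.X 1} ∧
    Module.finrank ℂ (MvPolynomial (Fin 2) ℂ ⧸ I) = ℓ ∧
    ∃ g ∈ I, multAtOrigin g = 1

/-- The curve `f = 0` contains a curvilinear scheme of length `ℓ` supported at the origin. -/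
def ContainsCurvilinear (f : MvPolynomial (Fin 2) ℂ) (ℓ : ℕ) : Prop :=
  ∃ I : Ideal (MvPolynomial (Fin 2) ℂ), IsCurvilinearAtOrigin I ℓ ∧ f ∈ I

/-! A curvilinear scheme of length `ℓ` in `C` is a smooth germ cut off at order `ℓ`, so the
statement concerns the contact orders of `C` at `P` with smooth germs. In coordinates these germs
are graphs `X j = h (X i)`, and contact at least `ℓ` means that `T ^ ℓ` divides `f` restricted to
the graph (`containsCurvilinear_iff`).

Blowing up a double point lowers the contact order of a graph by two, since `f` pulls back to the
square of the exceptional coordinate times the strict transform (`hasGraphOfSlope_add_two_iff`). The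
points above `P` are the zeros of the tangent quadratic form. Two simple zeros give two smooth
branches transverse to the exceptional line, hence one blow-up, two points and unbounded contact. A
double zero gives a single point: either smooth and tangent to the exceptional line, where contact
stops at 3, or again a double point. In the last case the blow-up count rises by one, the number of
points is unchanged and a finite bound `2 r + 1` becomes `2 (r + 1) + 1`. Thus contact orders are
unbounded with two final points and bounded exactly by `2 r + 1` with one
(`ContactDeterminesResolution`), and all three claims follow.

Termination uses reducedness. A discriminant puts `X i ^ N * u`, with `u` nonzero at the origin,
into the ideal of `f` and its partial derivatives; each blow-up to a further double point lowers `N`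
by one (`contactDeterminesResolution_of_pow_mem`). -/

open MvPolynomial

/-! ### Substitutions and expansions at the origin -/

/-- The substitution `X i ↦ u`, `X j ↦ v` for the other index `j`. -/
noncomputable def pairEval {S : Type*} [CommRing S] [Algebra ℂ S] (i : Fin 2) (u v : S) :
    MvPolynomial (Fin 2) ℂ →ₐ[ℂ] S :=
  aeval (fun k => if k = i then u else v)

@[simp] lemma pairEval_X_self {S : Type*} [CommRing S] [Algebra ℂ S] (i : Fin 2) (u v : S) :
    pairEval i u v (X i) = u := by simp [pairEval]

lemma pairEval_X_of_ne {S : Type*} [CommRing S] [Algebra ℂ S] {i j : Fin 2} (hij : i ≠ j)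
    (u v : S) : pairEval i u v (X j) = v := by simp [pairEval, hij.symm]

lemma eq_or_eq_of_ne {i j : Fin 2} (hij : i ≠ j) (k : Fin 2) : k = i ∨ k = j := by omega

lemma algHom_ext_of_ne {S : Type*} [CommRing S] [Algebra ℂ S] {i j : Fin 2} (hij : i ≠ j)
    {φ ψ : MvPolynomial (Fin 2) ℂ →ₐ[ℂ] S} (hi : φ (X i) = ψ (X i)) (hj : φ (X j) = ψ (X j)) :
    φ = ψ := by
  ext k
  rcases eq_or_eq_of_ne hij k with rfl | rfl
  · exact hi
  · exact hj

lemma algHom_comp_pairEval {S T : Type*} [CommRing S] [Algebra ℂ S] [CommRing T] [Algebra ℂ T]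
    (φ : S →ₐ[ℂ] T) (i : Fin 2) (u v : S) (f : MvPolynomial (Fin 2) ℂ) :
    φ (pairEval i u v f) = pairEval i (φ u) (φ v) f := by
  obtain ⟨j, hij⟩ : ∃ j, i ≠ j := ⟨i + 1, by omega⟩
  have : φ.comp (pairEval i u v) = pairEval i (φ u) (φ v) :=
    algHom_ext_of_ne hij (by simp) (by simp [pairEval_X_of_ne hij])
  exact DFunLike.congr_fun this f

lemma pairEval_swap {S : Type*} [CommRing S] [Algebra ℂ S] {i j : Fin 2} (hij : i ≠ j)
    (u v : S) : pairEval i u v = pairEval j v u :=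
  algHom_ext_of_ne hij (by simp [pairEval_X_of_ne hij.symm]) (by simp [pairEval_X_of_ne hij])

lemma exists_linear_expansion {i j : Fin 2} (hij : i ≠ j) (f : MvPolynomial (Fin 2) ℂ) :
    ∃ p q, f = C (constantCoeff f) + X i * p + X j * q := by
  induction f using MvPolynomial.induction_on with
  | C a => exact ⟨0, 0, by simp⟩
  | add f g hf hg =>
    obtain ⟨p, q, h⟩ := hf
    obtain ⟨p', q', h'⟩ := hg
    refine ⟨p + p', q + q', ?_⟩
    rw [map_add, map_add]
    linear_combination h + h'
  | mul_X f k _ =>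
    rcases eq_or_eq_of_ne hij k with rfl | rfl
    · exact ⟨f, 0, by simp [mul_comm]⟩
    · exact ⟨0, f, by simp [mul_comm]⟩

lemma constantCoeff_pderiv_left {i j : Fin 2} (hij : i ≠ j) (c : ℂ)
    (p q : MvPolynomial (Fin 2) ℂ) :
    constantCoeff (pderiv i (C c + X i * p + X j * q)) = constantCoeff p := by
  simp [pderiv_X_of_ne hij.symm]

lemma exists_quadratic_expansion {i j : Fin 2} (hij : i ≠ j) {f : MvPolynomial (Fin 2) ℂ}
    (h0 : constantCoeff f = 0) (h1 : ∀ k, constantCoeff (pderiv k f) = 0) :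
    ∃ a b d, f = X i ^ 2 * a + X i * X j * b + X j ^ 2 * d := by
  obtain ⟨p, q, hf⟩ := exists_linear_expansion hij f
  have hp : constantCoeff p = 0 := by
    rw [← constantCoeff_pderiv_left hij (constantCoeff f) p q, ← hf, h1]
  have hq : constantCoeff q = 0 := by
    rw [← constantCoeff_pderiv_left hij.symm (constantCoeff f) q p, add_right_comm, ← hf, h1]
  obtain ⟨p₁, p₂, ep⟩ := exists_linear_expansion hij p
  obtain ⟨q₁, q₂, eq⟩ := exists_linear_expansion hij q
  rw [hp, map_zero, zero_add] at ep
  rw [hq, map_zero, zero_add] at eq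
  rw [h0, map_zero, zero_add] at hf
  refine ⟨p₁, p₂ + q₁, q₂, ?_⟩
  linear_combination hf + X i * ep + X j * eq

/-! ### Multiplicity at the origin -/

lemma one_le_multAtOrigin_iff (f : MvPolynomial (Fin 2) ℂ) :
    1 ≤ multAtOrigin f ↔ constantCoeff f = 0 := by
  rw [multAtOrigin, MvPowerSeries.one_le_order_iff_constCoeff_eq_zero,
    ← MvPowerSeries.coeff_zero_eq_constantCoeff_apply, coeff_coe, constantCoeff_eq]

lemma le_multAtOrigin_iff (f : MvPolynomial (Fin 2) ℂ) (n : ℕ) :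
    n ≤ multAtOrigin f ↔ ∀ d, d.degree < n → coeff d f = 0 := by
  constructor
  · intro h d hd
    rw [← coeff_coe]
    exact MvPowerSeries.coeff_of_lt_order (lt_of_lt_of_le (by exact_mod_cast hd) h)
  · intro h
    refine MvPowerSeries.nat_le_order fun d hd => ?_
    rw [coeff_coe]
    exact h d hd

lemma le_multAtOrigin_add {f g : MvPolynomial (Fin 2) ℂ} {n : ℕ} (hf : n ≤ multAtOrigin f)
    (hg : n ≤ multAtOrigin g) : n ≤ multAtOrigin (f + g) := by
  rw [le_multAtOrigin_iff] at *
  intro d hd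
  rw [coeff_add, hf d hd, hg d hd, add_zero]

lemma le_multAtOrigin_X_mul {f : MvPolynomial (Fin 2) ℂ} {n : ℕ} (hf : n ≤ multAtOrigin f)
    (k : Fin 2) : (n + 1 : ℕ) ≤ multAtOrigin (X k * f) := by
  rw [le_multAtOrigin_iff] at *
  intro d hd
  rw [coeff_X_mul']
  split_ifs with h
  · refine hf _ ?_
    have h1 : Finsupp.single k 1 ≤ d := by
      rw [Finsupp.single_le_iff]
      exact Nat.one_le_iff_ne_zero.2 (Finsupp.mem_support_iff.1 h)
    have h2 := congrArg Finsupp.degree (tsub_add_cancel_of_le h1)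
    rw [map_add, Finsupp.degree_single] at h2
    omega
  · rfl

lemma zero_le_multAtOrigin (f : MvPolynomial (Fin 2) ℂ) : ((0 : ℕ) : ℕ∞) ≤ multAtOrigin f := by
  simp

lemma two_le_multAtOrigin_quadratic (i j : Fin 2) (a b d : MvPolynomial (Fin 2) ℂ) :
    2 ≤ multAtOrigin (X i ^ 2 * a + X i * X j * b + X j ^ 2 * d) := by
  have key : ∀ (k l : Fin 2) (p : MvPolynomial (Fin 2) ℂ),
      ((2 : ℕ) : ℕ∞) ≤ multAtOrigin (X k * (X l * p)) := fun k l p =>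
    le_multAtOrigin_X_mul (le_multAtOrigin_X_mul (zero_le_multAtOrigin p) l) k
  have e : X i ^ 2 * a + X i * X j * b + X j ^ 2 * d =
      X i * (X i * a) + X i * (X j * b) + X j * (X j * d) := by ring
  rw [e]
  exact le_multAtOrigin_add (le_multAtOrigin_add (key i i a) (key i j b)) (key j j d)

lemma two_le_multAtOrigin_iff (f : MvPolynomial (Fin 2) ℂ) :
    2 ≤ multAtOrigin f ↔ constantCoeff f = 0 ∧ ∀ k, constantCoeff (pderiv k f) = 0 := by
  constructor
  · intro h
    have h' := (le_multAtOrigin_iff f 2).1 h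
    have h0 : constantCoeff f = 0 := h' 0 (by simp)
    refine ⟨h0, fun k => ?_⟩
    obtain ⟨j, hij⟩ : ∃ j, k ≠ j := ⟨k + 1, by omega⟩
    obtain ⟨p, q, hf⟩ := exists_linear_expansion hij f
    have h1 := h' (Finsupp.single k 1) (by simp)
    rw [hf, constantCoeff_pderiv_left hij]
    rw [hf, h0] at h1
    simpa [coeff_X_mul', hij, Finsupp.single_apply, hij.symm, ← constantCoeff_eq]
      using h1
  · rintro ⟨h0, h1⟩
    obtain ⟨a, b, d, rfl⟩ := exists_quadratic_expansion (i := 0) (j := 1) (by decide) h0 h1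
    exact two_le_multAtOrigin_quadratic _ _ _ _ _

lemma multAtOrigin_eq_one_iff (f : MvPolynomial (Fin 2) ℂ) :
    multAtOrigin f = 1 ↔ constantCoeff f = 0 ∧ ∃ k, constantCoeff (pderiv k f) ≠ 0 := by
  have h1 := one_le_multAtOrigin_iff f
  have h2 := two_le_multAtOrigin_iff f
  have h3 : multAtOrigin f = 1 ↔ 1 ≤ multAtOrigin f ∧ ¬ 2 ≤ multAtOrigin f := by
    rw [not_le, show (2 : ℕ∞) = 1 + 1 from rfl, ENat.lt_add_one_iff (by simp), le_antisymm_iff,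
      and_comm]
  rw [h3, h1, h2]
  push Not
  exact ⟨fun h => ⟨h.1, h.2 h.1⟩, fun h => ⟨h.1, fun _ => h.2⟩⟩

lemma multAtOrigin_quadratic_eq_two_iff {i j : Fin 2} (hij : i ≠ j)
    (a b d : MvPolynomial (Fin 2) ℂ) :
    multAtOrigin (X i ^ 2 * a + X i * X j * b + X j ^ 2 * d) = 2 ↔
      constantCoeff a ≠ 0 ∨ constantCoeff b ≠ 0 ∨ constantCoeff d ≠ 0 := by
  set f := X i ^ 2 * a + X i * X j * b + X j ^ 2 * d with hf
  have h2 : 2 ≤ multAtOrigin f := two_le_multAtOrigin_quadratic i j a b d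
  have h3 : multAtOrigin f = 2 ↔ ¬ ((3 : ℕ) : ℕ∞) ≤ multAtOrigin f := by
    rw [not_le, show (((3 : ℕ) : ℕ∞)) = 2 + 1 from rfl, ENat.lt_add_one_iff (by simp),
      le_antisymm_iff, and_iff_left h2]
  rw [h3, ← not_and_or, ← not_and_or, not_iff_not]
  have hf' : f = X i * (X i * a) + X i * (X j * b) + X j * (X j * d) := by rw [hf]; ring
  constructor
  · intro h
    rw [le_multAtOrigin_iff] at h
    have ha := h (Finsupp.single i 1 + Finsupp.single i 1) (by simp)
    have hb := h (Finsupp.single i 1 + Finsupp.single j 1) (by simp)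
    have hd := h (Finsupp.single j 1 + Finsupp.single j 1) (by simp)
    rw [hf'] at ha hb hd
    refine ⟨?_, ?_, ?_⟩
    · simpa [coeff_X_mul', Finsupp.single_apply, hij, hij.symm, ← constantCoeff_eq] using ha
    · simpa [coeff_X_mul', Finsupp.single_apply, hij, hij.symm, ← constantCoeff_eq] using hb
    · simpa [coeff_X_mul', Finsupp.single_apply, hij, hij.symm, ← constantCoeff_eq] using hd
  · rintro ⟨ha, hb, hd⟩
    have key : ∀ (k l : Fin 2) (p : MvPolynomial (Fin 2) ℂ), constantCoeff p = 0 →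
        ((3 : ℕ) : ℕ∞) ≤ multAtOrigin (X k * (X l * p)) := fun k l p hp =>
      le_multAtOrigin_X_mul (le_multAtOrigin_X_mul ((one_le_multAtOrigin_iff p).2 hp) l) k
    rw [hf']
    exact le_multAtOrigin_add (le_multAtOrigin_add (key i i a ha) (key i j b hb)) (key j j d hd)

/-! ### Contact with smooth graphs -/

lemma coeff_zero_pairEval (i : Fin 2) {u v : Polynomial ℂ} (hu : u.coeff 0 = 0)
    (hv : v.coeff 0 = 0) (f : MvPolynomial (Fin 2) ℂ) :
    (pairEval i u v f).coeff 0 = constantCoeff f := by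
  obtain ⟨j, hij⟩ : ∃ j, i ≠ j := ⟨i + 1, by omega⟩
  obtain ⟨p, q, hf⟩ := exists_linear_expansion hij f
  rw [hf]
  simp [pairEval_X_of_ne hij, Polynomial.mul_coeff_zero, hu, hv, ← algebraMap_eq]

/-- Taylor's formula, by induction on `f`. It serves for successive approximation, for replacing a
graph by a congruent one, and for division by the equation of a graph. -/
lemma pairEval_add_right {S : Type*} [CommRing S] [Algebra ℂ S] {i j : Fin 2} (hij : i ≠ j)
    (u v w : S) (f : MvPolynomial (Fin 2) ℂ) :
    ∃ r, pairEval i u (v + w) f =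
      pairEval i u v f + w * pairEval i u v (pderiv j f) + w ^ 2 * r := by
  induction f using MvPolynomial.induction_on with
  | C a => exact ⟨0, by simp [← algebraMap_eq]⟩
  | add f g hf hg =>
    obtain ⟨r, h⟩ := hf
    obtain ⟨r', h'⟩ := hg
    refine ⟨r + r', ?_⟩
    rw [map_add, map_add, map_add, map_add]
    linear_combination h + h'
  | mul_X f k hf =>
    obtain ⟨r, h⟩ := hf
    rcases eq_or_eq_of_ne hij k with rfl | rfl
    · refine ⟨r * u, ?_⟩
      rw [map_mul, map_mul, Derivation.leibniz, pderiv_X_of_ne hij, h]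
      simp
      ring
    · refine ⟨pairEval i u v (pderiv k f) + r * (v + w), ?_⟩
      rw [map_mul, map_mul, Derivation.leibniz, pderiv_X_self, h]
      simp [pairEval_X_of_ne hij]
      ring

/-- The germ `f = 0` meets some graph `X j = h (X i)` through the origin with contact order at
least `ℓ`. -/
def HasGraph (i : Fin 2) (f : MvPolynomial (Fin 2) ℂ) (ℓ : ℕ) : Prop :=
  ∃ h : Polynomial ℂ, h.coeff 0 = 0 ∧ Polynomial.X ^ ℓ ∣ pairEval i Polynomial.X h f

/-- As `HasGraph`, for graphs of slope `t` at the origin. -/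
def HasGraphOfSlope (i : Fin 2) (t : ℂ) (f : MvPolynomial (Fin 2) ℂ) (ℓ : ℕ) : Prop :=
  ∃ h : Polynomial ℂ, h.coeff 0 = 0 ∧ h.coeff 1 = t ∧
    Polynomial.X ^ ℓ ∣ pairEval i Polynomial.X h f

lemma hasGraph_iff (i : Fin 2) (f : MvPolynomial (Fin 2) ℂ) (ℓ : ℕ) :
    HasGraph i f ℓ ↔ ∃ t, HasGraphOfSlope i t f ℓ :=
  ⟨fun ⟨h, h0, hd⟩ => ⟨_, h, h0, rfl, hd⟩, fun ⟨_, h, h0, _, hd⟩ => ⟨h, h0, hd⟩⟩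

/-- The implicit function theorem, to finite order. -/
lemma hasGraph_of_pderiv_ne_zero {i j : Fin 2} (hij : i ≠ j) {f : MvPolynomial (Fin 2) ℂ}
    (h0 : constantCoeff f = 0) (h1 : constantCoeff (pderiv j f) ≠ 0) (ℓ : ℕ) :
    HasGraph i f ℓ := by
  suffices H : ∀ ℓ, HasGraph i f (ℓ + 1) by
    obtain ⟨h, hh, hd⟩ := H ℓ
    exact ⟨h, hh, (pow_dvd_pow _ ℓ.le_succ).trans hd⟩
  intro ℓ
  induction ℓ with
  | zero =>
    refine ⟨0, by simp, ?_⟩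
    rw [zero_add, pow_one, Polynomial.X_dvd_iff, coeff_zero_pairEval i (by simp) (by simp), h0]
  | succ ℓ ih =>
    obtain ⟨h, hh, p, hp⟩ := ih
    -- The correction `s T ^ (ℓ + 1)` changes the coefficient of `T ^ (ℓ + 1)` by `s` times the
    -- value of `pderiv j f` at the origin; this `s` cancels it.
    set s := -p.coeff 0 / constantCoeff (pderiv j f) with hs
    obtain ⟨r, hr⟩ := pairEval_add_right hij Polynomial.X h
      (Polynomial.C s * Polynomial.X ^ (ℓ + 1)) f
    refine ⟨h + Polynomial.C s * Polynomial.X ^ (ℓ + 1),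
      by simp [hh, Polynomial.mul_coeff_zero], ?_⟩
    have e : pairEval i Polynomial.X (h + Polynomial.C s * Polynomial.X ^ (ℓ + 1)) f =
        Polynomial.X ^ (ℓ + 1) * (p + Polynomial.C s * pairEval i Polynomial.X h (pderiv j f)
          + Polynomial.X * (Polynomial.X ^ ℓ * Polynomial.C s ^ 2 * r)) := by
      rw [hr, hp]; ring
    rw [e, pow_succ _ (ℓ + 1)]
    refine mul_dvd_mul_left _ (Polynomial.X_dvd_iff.2 ?_)
    simp only [Polynomial.coeff_add, Polynomial.mul_coeff_zero, Polynomial.coeff_C_zero,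
      Polynomial.coeff_X_zero, zero_mul, add_zero]
    rw [coeff_zero_pairEval i (by simp) hh, hs]
    field_simp
    ring

lemma exists_inverse_mod_X_pow {h : Polynomial ℂ} (h0 : h.coeff 0 = 0) (h1 : h.coeff 1 ≠ 0)
    (ℓ : ℕ) : ∃ k : Polynomial ℂ, k.coeff 0 = 0 ∧ k.coeff 1 = (h.coeff 1)⁻¹ ∧
      Polynomial.X ^ ℓ ∣ h.comp k - Polynomial.X := by
  obtain ⟨p, hp⟩ := Polynomial.X_dvd_iff.2 h0
  obtain ⟨q, hq⟩ : ∃ q, p = Polynomial.C (h.coeff 1) + Polynomial.X * q := by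
    obtain ⟨q, hq⟩ := Polynomial.X_dvd_sub_C (p := p)
    refine ⟨q, ?_⟩
    have : p.coeff 0 = h.coeff 1 := by rw [hp, Polynomial.coeff_X_mul]
    rw [← hq, this]; ring
  have hc : ∀ k : Polynomial ℂ, h.comp k = Polynomial.C (h.coeff 1) * k + k ^ 2 * q.comp k := by
    intro k
    conv_lhs => rw [hp, hq]
    simp
    ring
  have hij : (0 : Fin 2) ≠ 1 := by decide
  -- Here `k` solves `h (y) = x` for `y`. The precision `ℓ + 2` makes the coefficient of `T`
  -- available even when `ℓ = 0`, which fixes the slope of `k`.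
  obtain ⟨k, hk, hd⟩ := hasGraph_of_pderiv_ne_zero hij
    (f := C (h.coeff 1) * X 1 + X 1 ^ 2 * Polynomial.aeval (X 1) q - X 0)
    (by simp) (by simpa [pderiv_X_of_ne hij, Derivation.leibniz_pow] using h1) (ℓ + 2)
  have e : pairEval 0 Polynomial.X k
      (C (h.coeff 1) * X 1 + X 1 ^ 2 * Polynomial.aeval (X 1) q - X 0) =
      h.comp k - Polynomial.X := by
    rw [hc]
    simp [pairEval_X_of_ne hij, ← algebraMap_eq, ← Polynomial.aeval_algHom_apply,
      Polynomial.comp_eq_aeval]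
  rw [e] at hd
  refine ⟨k, hk, ?_, (pow_dvd_pow _ (by omega)).trans hd⟩
  have h2 := Polynomial.X_pow_dvd_iff.1 hd 1 (by omega)
  obtain ⟨k', hk'⟩ := Polynomial.X_dvd_iff.2 hk
  rw [hc, show k ^ 2 * q.comp k = Polynomial.X * (Polynomial.X * (k' ^ 2 * q.comp k)) by
    rw [show k ^ 2 = (Polynomial.X * k') ^ 2 by rw [← hk']]; ring] at h2
  simp only [Polynomial.coeff_sub, Polynomial.coeff_add, Polynomial.coeff_C_mul,
    Polynomial.coeff_X_mul, Polynomial.coeff_X_one, Polynomial.mul_coeff_zero,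
    Polynomial.coeff_X_zero, zero_mul, add_zero] at h2
  field_simp
  linear_combination h2

/-- A graph of nonzero slope is also a graph over the other axis. With `k` inverse to `h` modulo `T
^ ℓ`, restricting `f` to the new graph agrees modulo `T ^ ℓ` with the old restriction composed with
`k`, and `T` divides `k`. -/
lemma HasGraphOfSlope.swap {i j : Fin 2} (hij : i ≠ j) {t : ℂ} (ht : t ≠ 0)
    {f : MvPolynomial (Fin 2) ℂ} {ℓ : ℕ} (H : HasGraphOfSlope i t f ℓ) :
    HasGraphOfSlope j t⁻¹ f ℓ := by
  obtain ⟨h, h0, rfl, hd⟩ := H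
  obtain ⟨k, k0, k1, hk⟩ := exists_inverse_mod_X_pow h0 ht ℓ
  refine ⟨k, k0, k1, ?_⟩
  obtain ⟨r, hr⟩ := pairEval_add_right hij k (h.comp k) (Polynomial.X - h.comp k) f
  have hk' : Polynomial.X ^ ℓ ∣ Polynomial.X - h.comp k := (dvd_sub_comm).1 hk
  have e : pairEval i k (h.comp k) f = (pairEval i Polynomial.X h f).comp k := by
    simp only [Polynomial.comp_eq_aeval]
    rw [algHom_comp_pairEval, Polynomial.aeval_X]
  obtain ⟨c, hc⟩ := hd
  rw [add_sub_cancel, e, hc, Polynomial.mul_comp, Polynomial.X_pow_comp] at hr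
  rw [← pairEval_swap hij, hr]
  refine dvd_add (dvd_add ?_ (hk'.mul_right _)) ((hk'.trans (dvd_pow_self _ (by simp))).mul_right _)
  exact (pow_dvd_pow_of_dvd (Polynomial.X_dvd_iff.2 k0) ℓ).mul_right _

/-! ### Curvilinear schemes as truncated graphs -/

lemma span_X_eq_ker_constantCoeff :
    Ideal.span {X 0, X 1} =
      RingHom.ker (constantCoeff : MvPolynomial (Fin 2) ℂ →+* ℂ) := by
  apply le_antisymm
  · rw [Ideal.span_le]
    rintro _ (rfl | rfl) <;> simp
  · intro f hf
    obtain ⟨p, q, h⟩ := exists_linear_expansion (i := 0) (j := 1) (by decide) f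
    rw [RingHom.mem_ker] at hf
    rw [h, hf, map_zero, zero_add]
    exact Ideal.add_mem _ (Ideal.mul_mem_right _ _ (Ideal.subset_span (by simp)))
      (Ideal.mul_mem_right _ _ (Ideal.subset_span (by simp)))

lemma pairEval_X_aeval {S : Type*} [CommRing S] [Algebra ℂ S] (i : Fin 2) (u v : S)
    (p : Polynomial ℂ) : pairEval i u v (Polynomial.aeval (X i) p) = Polynomial.aeval u p := by
  rw [← Polynomial.aeval_algHom_apply, pairEval_X_self]

lemma pairEval_graph_surjective (i : Fin 2) (h : Polynomial ℂ) :
    Function.Surjective (pairEval i Polynomial.X h) := fun p =>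
  ⟨Polynomial.aeval (X i) p, by rw [pairEval_X_aeval, Polynomial.aeval_X_left_apply]⟩

/-- Division by the equation of a graph: the remainder is the restriction to it. The value of the
quotient at the origin is recorded so that the quotient can be cancelled modulo a primary ideal. -/
lemma exists_sub_graph_mul {i j : Fin 2} (hij : i ≠ j) {h : Polynomial ℂ} (h0 : h.coeff 0 = 0)
    (f : MvPolynomial (Fin 2) ℂ) :
    ∃ w, f = Polynomial.aeval (X i) (pairEval i Polynomial.X h f) +
        (X j - Polynomial.aeval (X i) h) * w ∧
      constantCoeff w = constantCoeff (pderiv j f) := by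
  set H : MvPolynomial (Fin 2) ℂ := Polynomial.aeval (X i) h with hH
  obtain ⟨r, hr⟩ := pairEval_add_right hij (X i) H (X j - H) f
  have hid : pairEval i (X i) (X j) = AlgHom.id ℂ (MvPolynomial (Fin 2) ℂ) :=
    algHom_ext_of_ne hij (by simp) (by simp [pairEval_X_of_ne hij])
  rw [add_sub_cancel, hid, AlgHom.id_apply] at hr
  have hH0 : constantCoeff H = 0 := by
    obtain ⟨p, rfl⟩ := Polynomial.X_dvd_iff.2 h0
    simp [hH]
  refine ⟨pairEval i (X i) H (pderiv j f) + (X j - H) * r, ?_, ?_⟩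
  · rw [algHom_comp_pairEval, Polynomial.aeval_X, ← hH]
    linear_combination hr
  · obtain ⟨p, q, hf⟩ := exists_linear_expansion hij (pderiv j f)
    rw [map_add, map_mul, map_sub, hH0, constantCoeff_X, sub_zero, zero_mul, add_zero]
    conv_lhs => rw [hf]
    simp [pairEval_X_of_ne hij, hH0, ← algebraMap_eq]

lemma ContainsCurvilinear.exists_hasGraph {f : MvPolynomial (Fin 2) ℂ} {ℓ : ℕ}
    (H : ContainsCurvilinear f ℓ) : ∃ i, HasGraph i f ℓ := by
  obtain ⟨I, ⟨hrad, hrank, g, hgI, hg⟩, hfI⟩ := H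
  obtain ⟨hg0, j, hj⟩ := (multAtOrigin_eq_one_iff g).1 hg
  obtain ⟨i, hij⟩ : ∃ i, i ≠ j := ⟨j + 1, by omega⟩
  rw [span_X_eq_ker_constantCoeff] at hrad
  have hmax : I.radical.IsMaximal := by
    rw [hrad]
    exact RingHom.ker_isMaximal_of_surjective _ fun a => ⟨C a, constantCoeff_C _ a⟩
  have hprim := Ideal.isPrimary_of_isMaximal_radical hmax
  obtain ⟨N, hN⟩ : ∃ N, (X i : MvPolynomial (Fin 2) ℂ) ^ N ∈ I := by
    have : X i ∈ I.radical := by rw [hrad]; simp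
    exact this
  -- Precision `N` suffices because `X i ^ N` already lies in `I`.
  obtain ⟨h, h0, hd⟩ := hasGraph_of_pderiv_ne_zero hij hg0 hj N
  refine ⟨i, h, h0, ?_⟩
  have hXI : ∀ p : Polynomial ℂ, Polynomial.X ^ N ∣ p → Polynomial.aeval (X i) p ∈ I := by
    rintro _ ⟨p, rfl⟩
    rw [map_mul, map_pow, Polynomial.aeval_X]
    exact I.mul_mem_right _ hN
  have hjI : X j - Polynomial.aeval (X i) h ∈ I := by
    obtain ⟨w, hw, hw0⟩ := exists_sub_graph_mul hij h0 g
    have hmem : (X j - Polynomial.aeval (X i) h) * w ∈ I := by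
      rw [← add_sub_cancel_left (Polynomial.aeval (X i) (pairEval i Polynomial.X h g))
        ((X j - Polynomial.aeval (X i) h) * w), ← hw]
      exact I.sub_mem hgI (hXI _ hd)
    -- The cofactor `w` is nonzero at the origin, hence outside the radical, so the primary ideal
    -- `I` contains the other factor.
    refine ((Ideal.isPrimary_iff.1 hprim).2 hmem).resolve_right fun hr => hj ?_
    rw [hrad, RingHom.mem_ker] at hr
    rw [← hw0, hr]
  let ψ : Polynomial ℂ →ₐ[ℂ] MvPolynomial (Fin 2) ℂ ⧸ I :=
    (Ideal.Quotient.mkₐ ℂ I).comp (Polynomial.aeval (X i))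
  have hψ : ∀ p, ψ (pairEval i Polynomial.X h p) = Ideal.Quotient.mk I p := by
    intro p
    obtain ⟨w, hw, -⟩ := exists_sub_graph_mul hij h0 p
    refine Ideal.Quotient.eq.2 ?_
    have e : Polynomial.aeval (X i) (pairEval i Polynomial.X h p) - p =
        -((X j - Polynomial.aeval (X i) h) * w) := by linear_combination -hw
    change Polynomial.aeval (X i) (pairEval i Polynomial.X h p) - p ∈ I
    rw [e]
    exact I.neg_mem (I.mul_mem_right _ hjI)
  have hsurj : Function.Surjective ψ := fun q => by
    obtain ⟨p, rfl⟩ := Ideal.Quotient.mk_surjective q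
    exact ⟨_, hψ p⟩
  have hker : Polynomial.X ^ N ∈ RingHom.ker ψ :=
    Ideal.Quotient.eq_zero_iff_mem.2 (hXI _ dvd_rfl)
  -- The kernel contains `T ^ N`, so it is generated by some `T ^ n`; comparing dimensions gives `n
  -- = ℓ`.
  obtain ⟨p, hp⟩ := (IsPrincipalIdealRing.principal (RingHom.ker ψ)).principal
  rw [Ideal.submodule_span_eq] at hp
  rw [hp, Ideal.mem_span_singleton, dvd_prime_pow Polynomial.prime_X] at hker
  obtain ⟨n, -, hn⟩ := hker
  rw [Ideal.span_singleton_eq_span_singleton.2 hn] at hp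
  have hn' : n = ℓ := by
    rw [← hrank, ← (Ideal.quotientKerAlgEquivOfSurjective hsurj).toLinearEquiv.finrank_eq,
      (Ideal.quotientEquivAlgOfEq ℂ hp).toLinearEquiv.finrank_eq,
      finrank_quotient_span_eq_natDegree, Polynomial.natDegree_X_pow]
  rw [← hn', ← Ideal.mem_span_singleton, ← hp, RingHom.mem_ker, hψ]
  exact Ideal.Quotient.eq_zero_iff_mem.2 hfI

/-- The scheme is the graph truncated at order `ℓ`, its ideal being the kernel of restriction modulo
`T ^ ℓ`. For `ℓ = 0` this is the unit ideal, which has no point; hence `1 ≤ ℓ`. -/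
lemma HasGraph.containsCurvilinear {i : Fin 2} {f : MvPolynomial (Fin 2) ℂ} {ℓ : ℕ}
    (H : HasGraph i f ℓ) (hℓ : 1 ≤ ℓ) : ContainsCurvilinear f ℓ := by
  obtain ⟨h, h0, hd⟩ := H
  obtain ⟨j, hij⟩ : ∃ j, i ≠ j := ⟨i + 1, by omega⟩
  let J : Ideal (Polynomial ℂ) := Ideal.span {Polynomial.X ^ ℓ}
  let ψ : MvPolynomial (Fin 2) ℂ →ₐ[ℂ] Polynomial ℂ ⧸ J :=
    (Ideal.Quotient.mkₐ ℂ J).comp (pairEval i Polynomial.X h)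
  have hsurj : Function.Surjective ψ :=
    (Ideal.Quotient.mkₐ_surjective ℂ J).comp (pairEval_graph_surjective i h)
  have hker : ∀ p, p ∈ RingHom.ker ψ ↔ Polynomial.X ^ ℓ ∣ pairEval i Polynomial.X h p := fun p =>
    Ideal.Quotient.eq_zero_iff_mem.trans Ideal.mem_span_singleton
  refine ⟨RingHom.ker ψ, ⟨?_, ?_, X j - Polynomial.aeval (X i) h, ?_, ?_⟩, (hker f).2 hd⟩
  · rw [span_X_eq_ker_constantCoeff]
    ext p
    rw [RingHom.mem_ker, ← coeff_zero_pairEval i Polynomial.coeff_X_zero h0,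
      ← Polynomial.X_dvd_iff]
    constructor
    · rintro ⟨n, hn⟩
      rw [hker, map_pow] at hn
      exact Polynomial.prime_X.dvd_of_dvd_pow ((dvd_pow_self _ (by omega)).trans hn)
    · intro hp
      refine ⟨ℓ, ?_⟩
      rw [hker, map_pow]
      exact pow_dvd_pow_of_dvd hp ℓ
  · rw [(Ideal.quotientKerAlgEquivOfSurjective hsurj).toLinearEquiv.finrank_eq,
      finrank_quotient_span_eq_natDegree, Polynomial.natDegree_X_pow]
  · rw [hker, map_sub, pairEval_X_of_ne hij, pairEval_X_aeval, Polynomial.aeval_X_left_apply,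
      sub_self]
    exact dvd_zero _
  · obtain ⟨p, rfl⟩ := Polynomial.X_dvd_iff.2 h0
    refine (multAtOrigin_eq_one_iff _).2 ⟨by simp, j, ?_⟩
    rw [map_sub, Derivation.map_aeval, pderiv_X_of_ne hij]
    simp

lemma containsCurvilinear_iff {f : MvPolynomial (Fin 2) ℂ} {ℓ : ℕ} (hℓ : 1 ≤ ℓ) :
    ContainsCurvilinear f ℓ ↔ ∃ i, HasGraph i f ℓ :=
  ⟨fun H => H.exists_hasGraph, fun ⟨_, H⟩ => H.containsCurvilinear hℓ⟩

/-! ### Blow-up charts and the drop of contact order -/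

/-- The index of the coordinate cutting out the exceptional line in the chart of
`strictTransform` used at the slope `q`. -/
def chartIndex : OnePoint ℂ → Fin 2
  | OnePoint.infty => 1
  | OnePoint.some _ => 0

/-- The index of the coordinate along the exceptional line in the chart of `strictTransform` used
at the slope `q`. -/
def chartCoindex : OnePoint ℂ → Fin 2
  | OnePoint.infty => 0
  | OnePoint.some _ => 1

/-- The slope `q`, measured in the chart of `strictTransform` used at `q`. -/
def chartSlope : OnePoint ℂ → ℂ
  | OnePoint.infty => 0
  | OnePoint.some t => t

lemma chartIndex_ne_chartCoindex (q : OnePoint ℂ) : chartIndex q ≠ chartCoindex q := by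
  induction q using OnePoint.rec <;> simp [chartIndex, chartCoindex]

/-- The pullback by the blow-up of the origin, in the chart centred at the slope `t`, with
exceptional line `X i = 0`. -/
noncomputable def blowUpPullback (i j : Fin 2) (t : ℂ) :
    MvPolynomial (Fin 2) ℂ →ₐ[ℂ] MvPolynomial (Fin 2) ℂ :=
  pairEval i (X i) (X i * (X j + C t))

@[simp] lemma blowUpPullback_X_left (i j : Fin 2) (t : ℂ) : blowUpPullback i j t (X i) = X i := by
  simp [blowUpPullback]

lemma blowUpPullback_X_right {i j : Fin 2} (hij : i ≠ j) (t : ℂ) :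
    blowUpPullback i j t (X j) = X i * (X j + C t) := by
  simp [blowUpPullback, pairEval_X_of_ne hij]

lemma blowUpPullback_eq_C_add {i j : Fin 2} (hij : i ≠ j) (t : ℂ) (f : MvPolynomial (Fin 2) ℂ) :
    ∃ s, blowUpPullback i j t f = C (constantCoeff f) + X i * s := by
  obtain ⟨p, q, hf⟩ := exists_linear_expansion hij f
  refine ⟨blowUpPullback i j t p + (X j + C t) * blowUpPullback i j t q, ?_⟩
  conv_lhs => rw [hf]
  simp only [map_add, map_mul, blowUpPullback_X_left, blowUpPullback_X_right hij, ← algebraMap_eq,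
    AlgHom.commutes]
  ring

lemma constantCoeff_blowUpPullback {i j : Fin 2} (hij : i ≠ j) (t : ℂ)
    (f : MvPolynomial (Fin 2) ℂ) :
    constantCoeff (blowUpPullback i j t f) = constantCoeff f := by
  obtain ⟨s, hs⟩ := blowUpPullback_eq_C_add hij t f
  simp [hs]

lemma exists_quadratic_of_mult_two {i j : Fin 2} (hij : i ≠ j) {f : MvPolynomial (Fin 2) ℂ}
    (hf : multAtOrigin f = 2) : ∃ a b d, f = X i ^ 2 * a + X i * X j * b + X j ^ 2 * d :=
  let h := (two_le_multAtOrigin_iff f).1 hf.ge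
  exists_quadratic_expansion hij h.1 h.2

lemma X_sq_dvd_blowUpPullback {i j : Fin 2} (hij : i ≠ j) (t : ℂ) {f : MvPolynomial (Fin 2) ℂ}
    (hf : multAtOrigin f = 2) : X i ^ 2 ∣ blowUpPullback i j t f := by
  obtain ⟨a, b, d, rfl⟩ := exists_quadratic_of_mult_two hij hf
  refine ⟨blowUpPullback i j t a + (X j + C t) * blowUpPullback i j t b +
    (X j + C t) ^ 2 * blowUpPullback i j t d, ?_⟩
  simp only [map_add, map_mul, map_pow, blowUpPullback_X_left, blowUpPullback_X_right hij]
  ring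

lemma divMonomial_X_sq_mul (i : Fin 2) (g : MvPolynomial (Fin 2) ℂ) :
    (X i ^ 2 * g).divMonomial (Finsupp.single i 2) = g := by
  rw [X_pow_eq_monomial, divMonomial_monomial_mul]

/-- The chart at infinity is the slope-zero chart with the coordinates exchanged, so later arguments
treat all points above the origin uniformly. -/
lemma blowUpPullback_eq_mul_strictTransform {f : MvPolynomial (Fin 2) ℂ}
    (hf : multAtOrigin f = 2) (q : OnePoint ℂ) :
    blowUpPullback (chartIndex q) (chartCoindex q) (chartSlope q) f =
      X (chartIndex q) ^ 2 * strictTransform f q := by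
  obtain ⟨g, hg⟩ := X_sq_dvd_blowUpPullback (chartIndex_ne_chartCoindex q) (chartSlope q) hf
  suffices strictTransform f q = g by rw [hg, this]
  rw [← divMonomial_X_sq_mul (chartIndex q) g, ← hg]
  induction q using OnePoint.rec with
  | infty =>
    have e : (aeval ![X 0 * X 1, X 1] : MvPolynomial (Fin 2) ℂ →ₐ[ℂ] MvPolynomial (Fin 2) ℂ) =
        blowUpPullback 1 0 0 :=
      algHom_ext_of_ne (i := 0) (j := 1) (by decide)
        (by simp [blowUpPullback_X_right (show (1 : Fin 2) ≠ 0 by decide), mul_comm]) (by simp)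
    change divMonomial (aeval ![X 0 * X 1, X 1] f) (Finsupp.single 1 (multAtOrigin f).toNat) = _
    rw [e, hf]
    rfl
  | coe t =>
    have e : (aeval ![X 0, X 0 * (X 1 + C t)] :
        MvPolynomial (Fin 2) ℂ →ₐ[ℂ] MvPolynomial (Fin 2) ℂ) = blowUpPullback 0 1 t :=
      algHom_ext_of_ne (i := 0) (j := 1) (by decide) (by simp)
        (by simp [blowUpPullback_X_right (show (0 : Fin 2) ≠ 1 by decide)])
    change divMonomial (aeval ![X 0, X 0 * (X 1 + C t)] f)
      (Finsupp.single 0 (multAtOrigin f).toNat) = _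
    rw [e, hf]
    rfl

/-- On the exceptional line the strict transform restricts to the tangent form `a + b y + d y²` at
`y = X j + t`; the coefficients are its Taylor coefficients at `t`. -/
lemma strictTransform_expansion {i j : Fin 2} (hij : i ≠ j) {t : ℂ}
    {a b d g : MvPolynomial (Fin 2) ℂ}
    (hg : blowUpPullback i j t (X i ^ 2 * a + X i * X j * b + X j ^ 2 * d) = X i ^ 2 * g) :
    ∃ s, g = C (constantCoeff d) * X j ^ 2 +
      C (constantCoeff b + 2 * constantCoeff d * t) * X j +
      C (constantCoeff a + constantCoeff b * t + constantCoeff d * t ^ 2) + X i * s := by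
  obtain ⟨a', ha⟩ := blowUpPullback_eq_C_add hij t a
  obtain ⟨b', hb⟩ := blowUpPullback_eq_C_add hij t b
  obtain ⟨d', hd⟩ := blowUpPullback_eq_C_add hij t d
  refine ⟨a' + (X j + C t) * b' + (X j + C t) ^ 2 * d', ?_⟩
  have hX : (X i : MvPolynomial (Fin 2) ℂ) ^ 2 ≠ 0 := pow_ne_zero _ (X_ne_zero i)
  apply mul_left_cancel₀ hX
  rw [← hg]
  simp only [map_add, map_mul, map_pow, blowUpPullback_X_left, blowUpPullback_X_right hij, ha, hb,
    hd, map_ofNat]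
  ring

/-- The contact order of a germ with a smooth curve of given slope drops by two under blow-up. -/
lemma hasGraphOfSlope_add_two_iff {i j : Fin 2} (hij : i ≠ j) {t : ℂ}
    {f g : MvPolynomial (Fin 2) ℂ} (hg : blowUpPullback i j t f = X i ^ 2 * g) (ℓ : ℕ) :
    HasGraphOfSlope i t f (ℓ + 2) ↔ HasGraph i g ℓ := by
  have key : ∀ h : Polynomial ℂ,
      pairEval i Polynomial.X (Polynomial.X * (h + Polynomial.C t)) f =
        Polynomial.X ^ 2 * pairEval i Polynomial.X h g := by
    intro h
    have e := congrArg (pairEval i Polynomial.X h) hg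
    rw [blowUpPullback, algHom_comp_pairEval] at e
    simp only [map_mul, map_pow, map_add, pairEval_X_self, pairEval_X_of_ne hij, ← algebraMap_eq,
      AlgHom.commutes] at e
    exact e
  have hX : (Polynomial.X : Polynomial ℂ) ^ 2 ≠ 0 := pow_ne_zero _ Polynomial.X_ne_zero
  constructor
  · rintro ⟨h, h0, h1, hd⟩
    obtain ⟨p, rfl⟩ := Polynomial.X_dvd_iff.2 h0
    rw [Polynomial.coeff_X_mul] at h1
    refine ⟨p - Polynomial.C t, by simp [h1], ?_⟩
    rw [← sub_add_cancel p (Polynomial.C t), key, pow_add, mul_comm (_ ^ ℓ)] at hd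
    exact (mul_dvd_mul_iff_left hX).1 hd
  · rintro ⟨h, h0, hd⟩
    refine ⟨Polynomial.X * (h + Polynomial.C t), by simp [Polynomial.mul_coeff_zero],
      by simp [h0], ?_⟩
    rw [key, pow_add, mul_comm (_ ^ ℓ)]
    exact mul_dvd_mul_left _ hd

/-- The two kinds of chart see every tangent direction: a graph over the second axis either has
slope zero, seen at infinity, or can be swapped. -/
lemma exists_hasGraph_iff (f : MvPolynomial (Fin 2) ℂ) (ℓ : ℕ) :
    (∃ i, HasGraph i f ℓ) ↔
      ∃ q, HasGraphOfSlope (chartIndex q) (chartSlope q) f ℓ := by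
  constructor
  · rintro ⟨i, H⟩
    obtain ⟨t, ht⟩ := (hasGraph_iff i f ℓ).1 H
    by_cases hi : i = 0
    · subst hi
      exact ⟨OnePoint.some t, ht⟩
    · obtain rfl : i = 1 := by omega
      by_cases h0 : t = 0
      · subst h0
        exact ⟨OnePoint.infty, ht⟩
      · exact ⟨OnePoint.some t⁻¹, ht.swap (show (1 : Fin 2) ≠ 0 by decide) h0⟩
  · rintro ⟨q, H⟩
    exact ⟨_, (hasGraph_iff _ _ _).2 ⟨_, H⟩⟩

lemma exists_hasGraph_add_two_iff {f : MvPolynomial (Fin 2) ℂ} (hf : multAtOrigin f = 2) (ℓ : ℕ) :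
    (∃ i, HasGraph i f (ℓ + 2)) ↔ ∃ q, HasGraph (chartIndex q) (strictTransform f q) ℓ := by
  rw [exists_hasGraph_iff]
  exact exists_congr fun q => hasGraphOfSlope_add_two_iff (chartIndex_ne_chartCoindex q)
    (blowUpPullback_eq_mul_strictTransform hf q) ℓ

lemma HasGraph.mono {i : Fin 2} {f : MvPolynomial (Fin 2) ℂ} {ℓ m : ℕ} (H : HasGraph i f ℓ)
    (hm : m ≤ ℓ) : HasGraph i f m :=
  let ⟨h, h0, hd⟩ := H
  ⟨h, h0, (pow_dvd_pow _ hm).trans hd⟩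

lemma hasGraph_one_iff {i : Fin 2} {f : MvPolynomial (Fin 2) ℂ} :
    HasGraph i f 1 ↔ constantCoeff f = 0 := by
  constructor
  · rintro ⟨h, h0, hd⟩
    rwa [pow_one, Polynomial.X_dvd_iff, coeff_zero_pairEval i (by simp) h0] at hd
  · intro h
    refine ⟨0, by simp, ?_⟩
    rwa [pow_one, Polynomial.X_dvd_iff, coeff_zero_pairEval i (by simp) (by simp)]

lemma hasGraph_two {f : MvPolynomial (Fin 2) ℂ} (hf : multAtOrigin f = 2) (i : Fin 2) :
    HasGraph i f 2 := by
  obtain ⟨j, hij⟩ : ∃ j, i ≠ j := ⟨i + 1, by omega⟩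
  obtain ⟨g, hg⟩ := X_sq_dvd_blowUpPullback hij 0 hf
  exact (hasGraph_iff _ _ _).2 ⟨0, (hasGraphOfSlope_add_two_iff hij hg 0).2
    ⟨0, by simp, by simp⟩⟩

/-! ### Points above a double point -/

/-- A nonzero binary quadratic form `a x² + b x y + d y²` has either two simple zeros or one double
zero on the projective line. -/
lemma binaryQuadraticForm_zeros {a b d : ℂ} (h : a ≠ 0 ∨ b ≠ 0 ∨ d ≠ 0) :
    let value : OnePoint ℂ → ℂ := fun q =>
      q.elim d fun t => a + b * t + d * t ^ 2
    let slope : OnePoint ℂ → ℂ := fun q => q.elim b fun t => b + 2 * d * t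
    let lead : OnePoint ℂ → ℂ := fun q => q.elim a fun _ => d
    (∃ q₁ q₂, q₁ ≠ q₂ ∧ slope q₁ ≠ 0 ∧ slope q₂ ≠ 0 ∧ ∀ q, value q = 0 ↔ q = q₁ ∨ q = q₂) ∨
      ∃ q₀, lead q₀ ≠ 0 ∧ slope q₀ = 0 ∧ ∀ q, value q = 0 ↔ q = q₀ := by
  intro value slope lead
  -- The value at infinity is `d`, so this separates the cases according to whether infinity is a
  -- zero.
  by_cases hd : d = 0
  · subst hd
    by_cases hb : b = 0
    · subst hb
      have ha : a ≠ 0 := by simpa using h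
      right
      refine ⟨OnePoint.infty, ha, rfl, fun q => ?_⟩
      induction q using OnePoint.rec with
      | infty => simp [value]
      | coe t => simp [value, ha]
    · left
      refine ⟨OnePoint.infty, ((-a / b : ℂ) : OnePoint ℂ), OnePoint.infty_ne_coe _,
        hb, ?_, fun q => ?_⟩
      · simp [slope, hb]
      · induction q using OnePoint.rec with
        | infty => simp [value]
        | coe t =>
          simp only [value, OnePoint.elim_some, OnePoint.coe_ne_infty, false_or,
            OnePoint.coe_eq_coe]
          rw [eq_div_iff hb]
          constructor <;> intro h <;> linear_combination h
  · obtain ⟨w, hw⟩ := IsAlgClosed.exists_pow_nat_eq (b ^ 2 - 4 * a * d) (n := 2) (by norm_num)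
    have hfac : ∀ t, a + b * t + d * t ^ 2 =
        d * ((t - (-b + w) / (2 * d)) * (t - (-b - w) / (2 * d))) := by
      intro t
      field_simp
      linear_combination hw
    by_cases hw0 : w = 0
    · right
      refine ⟨((-b / (2 * d) : ℂ) : OnePoint ℂ), hd, ?_, fun q => ?_⟩
      · simp only [slope, OnePoint.elim_some]
        field_simp
        ring
      · induction q using OnePoint.rec with
        | infty => simp [value, hd]
        | coe t =>
          simp only [value, OnePoint.elim_some, OnePoint.coe_eq_coe]
          rw [hfac, hw0]
          simp [hd, sub_eq_zero]
    · left
      refine ⟨(((-b + w) / (2 * d) : ℂ) : OnePoint ℂ), (((-b - w) / (2 * d) : ℂ) : OnePoint ℂ),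
        ?_, ?_, ?_, fun q => ?_⟩
      · rw [Ne, OnePoint.coe_eq_coe, div_left_inj' (by simpa using hd)]
        intro h
        exact hw0 (by linear_combination h / 2)
      · simp only [slope, OnePoint.elim_some]
        rw [show b + 2 * d * ((-b + w) / (2 * d)) = w by field_simp; ring]
        exact hw0
      · simp only [slope, OnePoint.elim_some]
        rw [show b + 2 * d * ((-b - w) / (2 * d)) = -w by field_simp; ring]
        exact neg_ne_zero.2 hw0
      · induction q using OnePoint.rec with
        | infty => simp [value, hd]
        | coe t =>
          simp only [value, OnePoint.elim_some, OnePoint.coe_eq_coe]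
          rw [hfac]
          simp [hd, sub_eq_zero]

/-- The points above a double point: either two simple ones or a single double one. -/
lemma strictTransform_dichotomy {f : MvPolynomial (Fin 2) ℂ} (hf : multAtOrigin f = 2) :
    (∃ q₁ q₂, q₁ ≠ q₂ ∧
      constantCoeff (pderiv (chartCoindex q₁) (strictTransform f q₁)) ≠ 0 ∧
      constantCoeff (pderiv (chartCoindex q₂) (strictTransform f q₂)) ≠ 0 ∧
      ∀ q, constantCoeff (strictTransform f q) = 0 ↔ q = q₁ ∨ q = q₂) ∨
    ∃ q₀ c s, c ≠ 0 ∧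
      strictTransform f q₀ = C c * X (chartCoindex q₀) ^ 2 + X (chartIndex q₀) * s ∧
      ∀ q, constantCoeff (strictTransform f q) = 0 ↔ q = q₀ := by
  obtain ⟨a, b, d, rfl⟩ := exists_quadratic_of_mult_two (show (0 : Fin 2) ≠ 1 by decide) hf
  have hexp : ∀ q : OnePoint ℂ, ∃ s,
      strictTransform (X 0 ^ 2 * a + X 0 * X 1 * b + X 1 ^ 2 * d) q =
        C (q.elim (constantCoeff a) fun _ => constantCoeff d) * X (chartCoindex q) ^ 2 +
        C (q.elim (constantCoeff b) fun t => constantCoeff b + 2 * constantCoeff d * t) *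
          X (chartCoindex q) +
        C (q.elim (constantCoeff d) fun t =>
          constantCoeff a + constantCoeff b * t + constantCoeff d * t ^ 2) +
        X (chartIndex q) * s := by
    intro q
    have hg := blowUpPullback_eq_mul_strictTransform hf q
    induction q using OnePoint.rec with
    | infty =>
      -- In the chart at infinity the roles of `a` and `d` are exchanged.
      rw [show X 0 ^ 2 * a + X 0 * X 1 * b + X 1 ^ 2 * d =
        X 1 ^ 2 * d + X 1 * X 0 * b + X 0 ^ 2 * a by ring] at hg ⊢
      obtain ⟨s, hs⟩ := strictTransform_expansion (chartIndex_ne_chartCoindex OnePoint.infty) hg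
      refine ⟨s, hs.trans ?_⟩
      simp [chartSlope]
    | coe t => exact strictTransform_expansion (chartIndex_ne_chartCoindex (t : OnePoint ℂ)) hg
  have hne := (multAtOrigin_quadratic_eq_two_iff (by decide) a b d).1 hf
  generalize hF : X 0 ^ 2 * a + X 0 * X 1 * b + X 1 ^ 2 * d = F at *
  have hcc : ∀ q, constantCoeff (strictTransform F q) =
      q.elim (constantCoeff d) fun t =>
          constantCoeff a + constantCoeff b * t + constantCoeff d * t ^ 2 := by
    intro q
    obtain ⟨s, hs⟩ := hexp q
    simp [hs]
  have hder : ∀ q, constantCoeff (pderiv (chartCoindex q) (strictTransform F q)) =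
      q.elim (constantCoeff b) fun t => constantCoeff b + 2 * constantCoeff d * t := by
    intro q
    obtain ⟨s, hs⟩ := hexp q
    rw [hs]
    simp [Derivation.leibniz_pow, pderiv_X_of_ne (chartIndex_ne_chartCoindex q)]
  rcases binaryQuadraticForm_zeros hne with ⟨q₁, q₂, hq, h₁, h₂, hz⟩ | ⟨q₀, hl, hs, hz⟩
  · left
    refine ⟨q₁, q₂, hq, by rwa [hder], by rwa [hder], fun q => ?_⟩
    rw [hcc]
    exact hz q
  · right
    obtain ⟨s, hs'⟩ := hexp q₀
    refine ⟨q₀, _, s, hl, ?_, fun q => ?_⟩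
    · have hz₀ := (hz q₀).2 rfl
      beta_reduce at hs hz₀ ⊢
      rw [hs', hs, hz₀]
      simp
    · rw [hcc]
      exact hz q

/-! ### Resolution data and contact orders through one blow-up -/

lemma resolvedBy_iff_of_smooth {f : MvPolynomial (Fin 2) ℂ} (hf : multAtOrigin f = 1) (r k : ℕ) :
    ResolvedBy f r k ↔ r = 0 ∧ k = 1 := by
  constructor
  · intro H
    cases H with
    | smooth => exact ⟨rfl, rfl⟩
    | blowUp _ h =>
      rw [hf] at h
      exact absurd h (by decide)
  · rintro ⟨rfl, rfl⟩
    exact ResolvedBy.smooth f hf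

lemma resolvedBy_iff_of_node {f : MvPolynomial (Fin 2) ℂ} (hf : multAtOrigin f = 2)
    {q₁ q₂ : OnePoint ℂ} (hq : q₁ ≠ q₂) (h₁ : multAtOrigin (strictTransform f q₁) = 1)
    (h₂ : multAtOrigin (strictTransform f q₂) = 1)
    (hz : ∀ q, constantCoeff (strictTransform f q) = 0 ↔ q = q₁ ∨ q = q₂) (r k : ℕ) :
    ResolvedBy f r k ↔ r = 1 ∧ k = 2 := by
  classical
  constructor
  · intro H
    cases H with
    | smooth _ h =>
      rw [hf] at h
      exact absurd h (by decide)
    | blowUp _ h S hS r k hr =>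
      obtain rfl : S = {q₁, q₂} := by
        ext q
        rw [hS, hz]
        simp
      have e₁ := (resolvedBy_iff_of_smooth h₁ _ _).1 (hr q₁ (by simp))
      have e₂ := (resolvedBy_iff_of_smooth h₂ _ _).1 (hr q₂ (by simp))
      rw [Finset.sum_pair hq, Finset.sum_pair hq, e₁.1, e₂.1, e₁.2, e₂.2]
      exact ⟨rfl, rfl⟩
  · rintro ⟨rfl, rfl⟩
    have H := ResolvedBy.blowUp f hf.ge {q₁, q₂} (fun q => by rw [hz]; simp) (fun _ => 0)
      (fun _ => 1) (fun q hqS => by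
        rcases Finset.mem_insert.1 hqS with rfl | hqS
        · exact ResolvedBy.smooth _ h₁
        · obtain rfl := Finset.mem_singleton.1 hqS
          exact ResolvedBy.smooth _ h₂)
    rwa [Finset.sum_pair hq, Finset.sum_pair hq] at H

lemma resolvedBy_iff_of_unique {f : MvPolynomial (Fin 2) ℂ} (hf : multAtOrigin f = 2)
    {q₀ : OnePoint ℂ} (hz : ∀ q, constantCoeff (strictTransform f q) = 0 ↔ q = q₀) (r k : ℕ) :
    ResolvedBy f r k ↔ ∃ r', r = r' + 1 ∧ ResolvedBy (strictTransform f q₀) r' k := by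
  constructor
  · intro H
    cases H with
    | smooth _ h =>
      rw [hf] at h
      exact absurd h (by decide)
    | blowUp _ h S hS r k hr =>
      obtain rfl : S = {q₀} := by
        ext q
        rw [hS, hz]
        simp
      rw [Finset.sum_singleton, Finset.sum_singleton]
      exact ⟨r q₀, add_comm _ _, hr q₀ (by simp)⟩
  · rintro ⟨r', rfl, H'⟩
    have H := ResolvedBy.blowUp f hf.ge {q₀} (fun q => by rw [hz]; simp) (fun _ => r')
      (fun _ => k) (fun q hqS => by
        obtain rfl := Finset.mem_singleton.1 hqS
        exact H')
    rwa [Finset.sum_singleton, Finset.sum_singleton, add_comm] at H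

/-- On a graph over `X i` through the origin the square has order at least two, so the linear
coefficient is the nonzero constant term of `s`. -/
lemma hasGraph_le_one_of_tangent {i j : Fin 2} (hij : i ≠ j) {c : ℂ}
    {s : MvPolynomial (Fin 2) ℂ} (hs : constantCoeff s ≠ 0) {ℓ : ℕ}
    (H : HasGraph i (C c * X j ^ 2 + X i * s) ℓ) : ℓ ≤ 1 := by
  by_contra! hℓ
  obtain ⟨h, h0, hd⟩ := H
  have h1 := Polynomial.X_pow_dvd_iff.1 hd 1 hℓ
  obtain ⟨p, rfl⟩ := Polynomial.X_dvd_iff.2 h0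
  rw [map_add, map_mul, map_mul, map_pow, pairEval_X_self, pairEval_X_of_ne hij,
    show pairEval i Polynomial.X (Polynomial.X * p) (C c) * (Polynomial.X * p) ^ 2 =
      Polynomial.X * (Polynomial.X * (pairEval i Polynomial.X (Polynomial.X * p) (C c) * p ^ 2))
      by ring] at h1
  simp only [Polynomial.coeff_add, Polynomial.coeff_X_mul, Polynomial.mul_coeff_zero,
    Polynomial.coeff_X_zero, zero_mul, zero_add] at h1
  rw [coeff_zero_pairEval i (by simp) h0] at h1
  exact hs h1

/-- Blowing down accounts only for graphs over `X i`. A graph lost this way is tangent to the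
exceptional line; its contact is at most two, as `c` is the coefficient of `T ^ 2`, and every graph
over `X i` does no worse than some graph of contact two. -/
lemma exists_hasGraph_iff_of_transverse {i j : Fin 2} (hij : i ≠ j) {c : ℂ} (hc : c ≠ 0)
    {g s : MvPolynomial (Fin 2) ℂ} (hg : multAtOrigin g = 2)
    (hs : g = C c * X j ^ 2 + X i * s) (ℓ : ℕ) :
    (∃ k, HasGraph k g ℓ) ↔ HasGraph i g ℓ := by
  refine ⟨?_, fun H => ⟨i, H⟩⟩
  rintro ⟨k, H⟩
  rcases eq_or_eq_of_ne hij k with rfl | rfl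
  · exact H
  · obtain ⟨t, ht⟩ := (hasGraph_iff _ _ _).1 H
    by_cases h0 : t = 0
    · refine (hasGraph_two hg i).mono ?_
      by_contra! hℓ
      subst h0
      obtain ⟨h, h0, h1, hd⟩ := ht
      obtain ⟨p, rfl⟩ := Polynomial.X_dvd_iff.2 h0
      rw [Polynomial.coeff_X_mul] at h1
      obtain ⟨p, rfl⟩ := Polynomial.X_dvd_iff.2 h1
      have hs0 : constantCoeff s = 0 := by
        have := ((two_le_multAtOrigin_iff g).1 hg.ge).2 i
        rw [hs] at this
        simpa [Derivation.leibniz_pow, pderiv_X_of_ne hij.symm] using this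
      have h2 := Polynomial.X_pow_dvd_iff.1 hd 2 hℓ
      have hz : (pairEval k Polynomial.X (Polynomial.X * (Polynomial.X * p)) s).coeff 0 = 0 := by
        rw [coeff_zero_pairEval k (by simp) (by simp [Polynomial.mul_coeff_zero]), hs0]
      rw [hs, map_add, map_mul, map_mul, map_pow, pairEval_X_self, pairEval_X_of_ne hij.symm,
        pow_two, ← algebraMap_eq, AlgHom.commutes] at h2
      simp only [Polynomial.algebraMap_eq, Polynomial.coeff_add, Polynomial.coeff_C_mul,
        Polynomial.coeff_X_mul, mul_assoc, Polynomial.coeff_X_one] at h2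
      rw [Polynomial.mul_coeff_zero, hz] at h2
      exact hc (by simpa using h2)
    · exact (hasGraph_iff _ _ _).2 ⟨_, ht.swap hij.symm h0⟩

/-- A germ resolved by exactly `r` blow-ups with `k` points over the origin has contact orders with
smooth curves that are unbounded if `k = 2` and bounded by `2 r + 1`, sharply, if `k = 1`. -/
def ContactDeterminesResolution (f : MvPolynomial (Fin 2) ℂ) : Prop :=
  ∃ r₀, 1 ≤ r₀ ∧
    (((∀ r k, ResolvedBy f r k ↔ r = r₀ ∧ k = 2) ∧ ∀ ℓ, ∃ i, HasGraph i f ℓ) ∨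
      ((∀ r k, ResolvedBy f r k ↔ r = r₀ ∧ k = 1) ∧
        ∀ ℓ, (∃ i, HasGraph i f ℓ) ↔ ℓ ≤ 2 * r₀ + 1))

lemma multAtOrigin_of_transverse {i j : Fin 2} (hij : i ≠ j) {c : ℂ} (hc : c ≠ 0)
    (s : MvPolynomial (Fin 2) ℂ) :
    (constantCoeff s ≠ 0 ∧ multAtOrigin (C c * X j ^ 2 + X i * s) = 1) ∨
      multAtOrigin (C c * X j ^ 2 + X i * s) = 2 := by
  by_cases hs : constantCoeff s = 0
  · right
    obtain ⟨p, q, h⟩ := exists_linear_expansion hij s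
    rw [hs, map_zero, zero_add] at h
    rw [show C c * X j ^ 2 + X i * s = X i ^ 2 * p + X i * X j * q + X j ^ 2 * C c by
      rw [h]; ring, multAtOrigin_quadratic_eq_two_iff hij]
    simp [hc]
  · left
    refine ⟨hs, (multAtOrigin_eq_one_iff _).2 ⟨by simp, i, ?_⟩⟩
    simpa [Derivation.leibniz_pow, pderiv_X_of_ne hij.symm] using hs

/-- Reduction to the strict transform: either the contact orders of a double point are governed
directly, or it has a unique infinitely near double point, with exceptional line transverse to its
tangent, to which the question is reduced. -/
lemma contactDeterminesResolution_or_reduction {f : MvPolynomial (Fin 2) ℂ}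
    (hf : multAtOrigin f = 2) :
    ContactDeterminesResolution f ∨
      ∃ q c s, c ≠ 0 ∧ multAtOrigin (strictTransform f q) = 2 ∧
        strictTransform f q = C c * X (chartCoindex q) ^ 2 + X (chartIndex q) * s ∧
        (ContactDeterminesResolution (strictTransform f q) → ContactDeterminesResolution f) := by
  rcases strictTransform_dichotomy hf with ⟨q₁, q₂, hq, h₁, h₂, hz⟩ | ⟨q₀, c, s, hc, hs, hz⟩
  · left
    have h0₁ := (hz q₁).2 (Or.inl rfl)
    have h0₂ := (hz q₂).2 (Or.inr rfl)
    refine ⟨1, le_rfl, Or.inl ⟨resolvedBy_iff_of_node hf hq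
      ((multAtOrigin_eq_one_iff _).2 ⟨h0₁, _, h₁⟩)
      ((multAtOrigin_eq_one_iff _).2 ⟨h0₂, _, h₂⟩) hz, fun ℓ => ?_⟩⟩
    obtain ⟨i, hi⟩ := (exists_hasGraph_add_two_iff hf ℓ).2
      ⟨q₁, hasGraph_of_pderiv_ne_zero (chartIndex_ne_chartCoindex q₁) h0₁ h₁ ℓ⟩
    exact ⟨i, hi.mono (by omega)⟩
  · have hij := chartIndex_ne_chartCoindex q₀
    -- Contact at least three leaves contact at least one after the blow-up, which forces the graph
    -- through the unique point `q₀`.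
    have hcontact : ∀ ℓ, (∃ i, HasGraph i f (ℓ + 3)) ↔
        HasGraph (chartIndex q₀) (strictTransform f q₀) (ℓ + 1) := by
      intro ℓ
      rw [show ℓ + 3 = (ℓ + 1) + 2 from rfl, exists_hasGraph_add_two_iff hf]
      constructor
      · rintro ⟨q, H⟩
        obtain rfl := (hz q).1 (hasGraph_one_iff.1 (H.mono (by omega)))
        exact H
      · exact fun H => ⟨q₀, H⟩
    have hsmall : ∀ ℓ ≤ 2, ∃ i, HasGraph i f ℓ := fun ℓ hℓ => ⟨0, (hasGraph_two hf 0).mono hℓ⟩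
    rcases multAtOrigin_of_transverse hij hc s with ⟨hs0, hm⟩ | hm
    · left
      refine ⟨1, le_rfl, Or.inr ⟨fun r k => ?_, fun ℓ => ?_⟩⟩
      · rw [resolvedBy_iff_of_unique hf hz, hs]
        simp only [resolvedBy_iff_of_smooth hm]
        constructor
        · rintro ⟨r', rfl, rfl, rfl⟩
          exact ⟨rfl, rfl⟩
        · rintro ⟨rfl, rfl⟩
          exact ⟨0, rfl, rfl, rfl⟩
      · rcases le_or_gt ℓ 2 with hℓ | hℓ
        · exact iff_of_true (hsmall ℓ hℓ) (by omega)
        · obtain ⟨m, rfl⟩ := Nat.exists_eq_add_of_le' hℓ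
          change (∃ i, HasGraph i f (m + 3)) ↔ _
          rw [hcontact]
          constructor
          · intro H
            rw [hs] at H
            have := hasGraph_le_one_of_tangent hij hs0 H
            change m + 3 ≤ 2 * 1 + 1
            omega
          · intro hm'
            obtain rfl : m = 0 := by omega
            exact hasGraph_one_iff.2 ((hz q₀).2 rfl)
    · right
      rw [← hs] at hm
      refine ⟨q₀, c, s, hc, hm, hs, ?_⟩
      have hrec : ∀ ℓ, (∃ i, HasGraph i f (ℓ + 3)) ↔
          ∃ i, HasGraph i (strictTransform f q₀) (ℓ + 1) := fun ℓ => by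
        rw [hcontact, exists_hasGraph_iff_of_transverse hij hc hm hs]
      rintro ⟨r₀, hr₀, ⟨hR, hℓ⟩ | ⟨hR, hℓ⟩⟩
      · refine ⟨r₀ + 1, by omega, Or.inl ⟨fun r k => ?_, fun ℓ => ?_⟩⟩
        · rw [resolvedBy_iff_of_unique hf hz]
          simp only [hR]
          constructor
          · rintro ⟨r', rfl, rfl, rfl⟩
            exact ⟨rfl, rfl⟩
          · rintro ⟨rfl, rfl⟩
            exact ⟨r₀, rfl, rfl, rfl⟩
        · obtain ⟨i, hi⟩ := (hrec ℓ).2 (hℓ _)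
          exact ⟨i, hi.mono (by omega)⟩
      · refine ⟨r₀ + 1, by omega, Or.inr ⟨fun r k => ?_, fun ℓ => ?_⟩⟩
        · rw [resolvedBy_iff_of_unique hf hz]
          simp only [hR]
          constructor
          · rintro ⟨r', rfl, rfl, rfl⟩
            exact ⟨rfl, rfl⟩
          · rintro ⟨rfl, rfl⟩
            exact ⟨r₀, rfl, rfl, rfl⟩
        · rcases le_or_gt ℓ 2 with h | h
          · exact iff_of_true (hsmall ℓ h) (by omega)
          · obtain ⟨m, rfl⟩ := Nat.exists_eq_add_of_le' h
            change (∃ i, HasGraph i f (m + 3)) ↔ m + 3 ≤ _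
            rw [hrec, hℓ]
            omega

/-! ### Termination through the singular ideal -/

/-- The ideal of the singular subscheme of the affine plane curve `f = 0`. -/
noncomputable def singularIdeal (f : MvPolynomial (Fin 2) ℂ) : Ideal (MvPolynomial (Fin 2) ℂ) :=
  Ideal.span (insert f (Set.range fun k => pderiv k f))

lemma self_mem_singularIdeal (f : MvPolynomial (Fin 2) ℂ) : f ∈ singularIdeal f :=
  Ideal.subset_span (Set.mem_insert _ _)

lemma pderiv_mem_singularIdeal (f : MvPolynomial (Fin 2) ℂ) (k : Fin 2) :
    pderiv k f ∈ singularIdeal f :=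
  Ideal.subset_span (Set.mem_insert_of_mem _ ⟨k, rfl⟩)

lemma singularIdeal_le_iff {f : MvPolynomial (Fin 2) ℂ} {I : Ideal (MvPolynomial (Fin 2) ℂ)} :
    singularIdeal f ≤ I ↔ f ∈ I ∧ ∀ k, pderiv k f ∈ I := by
  rw [singularIdeal, Ideal.span_le, Set.insert_subset_iff, Set.range_subset_iff]
  rfl

lemma pderiv_pairEval {i j : Fin 2} (hij : i ≠ j) (k : Fin 2) (u v f : MvPolynomial (Fin 2) ℂ) :
    pderiv k (pairEval i u v f) =
      pairEval i u v (pderiv i f) * pderiv k u + pairEval i u v (pderiv j f) * pderiv k v := by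
  induction f using MvPolynomial.induction_on with
  | C a => simp [← algebraMap_eq]
  | add f g hf hg =>
    simp only [map_add]
    linear_combination hf + hg
  | mul_X f l hf =>
    rcases eq_or_eq_of_ne hij l with rfl | rfl
    · rw [map_mul, Derivation.leibniz, hf, Derivation.leibniz, Derivation.leibniz, pderiv_X_self,
        pderiv_X_of_ne hij]
      simp
      ring
    · rw [map_mul, Derivation.leibniz, hf, Derivation.leibniz, Derivation.leibniz, pderiv_X_self,
        pderiv_X_of_ne hij.symm]
      simp [pairEval_X_of_ne hij]
      ring

/-- The pullback of the singular ideal of a double point is divisible by the exceptional line, with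
quotient inside the singular ideal of the strict transform. -/
lemma blowUpPullback_mem_of_mem_singularIdeal {i j : Fin 2} (hij : i ≠ j) {t : ℂ}
    {f g : MvPolynomial (Fin 2) ℂ} (hg : blowUpPullback i j t f = X i ^ 2 * g)
    {p : MvPolynomial (Fin 2) ℂ} (hp : p ∈ singularIdeal f) :
    ∃ p' ∈ singularIdeal g, blowUpPullback i j t p = X i * p' := by
  have hX : (X i : MvPolynomial (Fin 2) ℂ) ≠ 0 := X_ne_zero i
  -- Chain rule in `X j` for the identity `hg`, with one factor `X i` cancelled; the `X i`
  -- derivative is then obtained from this one.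
  have hj : blowUpPullback i j t (pderiv j f) = X i * pderiv j g := by
    have e := pderiv_pairEval hij j (X i) (X i * (X j + C t)) f
    rw [← blowUpPullback, hg] at e
    simp only [Derivation.leibniz, Derivation.leibniz_pow, pderiv_X_of_ne hij, pderiv_X_self,
      map_add, pderiv_C, smul_eq_mul] at e
    apply mul_left_cancel₀ hX
    linear_combination -e
  have hi : blowUpPullback i j t (pderiv i f) =
      X i * (2 * g + X i * pderiv i g - (X j + C t) * pderiv j g) := by
    have e := pderiv_pairEval hij i (X i) (X i * (X j + C t)) f
    rw [← blowUpPullback, hg, hj] at e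
    simp only [Derivation.leibniz, Derivation.leibniz_pow, pderiv_X_of_ne hij.symm, pderiv_X_self,
      map_add, pderiv_C, smul_eq_mul, nsmul_eq_mul] at e
    push_cast at e
    linear_combination -e
  suffices H : singularIdeal f ≤
      (Ideal.span {X i} * singularIdeal g).comap (blowUpPullback i j t) by
    obtain ⟨p', hp', h⟩ := Ideal.mem_span_singleton_mul.1 (H hp)
    exact ⟨p', hp', h.symm⟩
  have hmem : ∀ q ∈ singularIdeal g, X i * q ∈ Ideal.span {X i} * singularIdeal g := fun q hq =>
    Ideal.mem_span_singleton_mul.2 ⟨q, hq, rfl⟩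
  rw [singularIdeal_le_iff]
  refine ⟨?_, fun k => ?_⟩
  · rw [Ideal.mem_comap, hg, pow_two, mul_assoc]
    exact hmem _ (Ideal.mul_mem_left _ _ (self_mem_singularIdeal g))
  · rw [Ideal.mem_comap]
    rcases eq_or_eq_of_ne hij k with rfl | rfl
    · rw [hi]
      exact hmem _ (Ideal.sub_mem _ (Ideal.add_mem _
        (Ideal.mul_mem_left _ _ (self_mem_singularIdeal g))
        (Ideal.mul_mem_left _ _ (pderiv_mem_singularIdeal g _)))
        (Ideal.mul_mem_left _ _ (pderiv_mem_singularIdeal g _)))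
    · rw [hj]
      exact hmem _ (pderiv_mem_singularIdeal g _)

lemma constantCoeff_eq_zero_of_mem_singularIdeal {f : MvPolynomial (Fin 2) ℂ}
    (hf : multAtOrigin f = 2) {p : MvPolynomial (Fin 2) ℂ} (hp : p ∈ singularIdeal f) :
    constantCoeff p = 0 :=
  singularIdeal_le_iff (I := RingHom.ker constantCoeff).2
    ((two_le_multAtOrigin_iff f).1 hf.ge) hp

/-- Embedded resolution terminates, with the exponent of a coordinate in the singular ideal as the
decreasing quantity. -/
lemma contactDeterminesResolution_of_pow_mem (N : ℕ) :
    ∀ {f : MvPolynomial (Fin 2) ℂ} {i j : Fin 2}, i ≠ j → multAtOrigin f = 2 →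
      ∀ {c s u : MvPolynomial (Fin 2) ℂ}, constantCoeff c ≠ 0 → f = c * X j ^ 2 + X i * s →
      constantCoeff u ≠ 0 → X i ^ N * u ∈ singularIdeal f → ContactDeterminesResolution f := by
  induction N with
  | zero =>
    intro f i j hij hf c s u hc hs hu hmem
    rw [pow_zero, one_mul] at hmem
    exact absurd (constantCoeff_eq_zero_of_mem_singularIdeal hf hmem) hu
  | succ N ih =>
    intro f i j hij hf c s u hc hs hu hmem
    rcases contactDeterminesResolution_or_reduction hf with h | ⟨q, c', s', hc', hm, hs', hred⟩
    · exact h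
    refine hred ?_
    have hq := chartIndex_ne_chartCoindex q
    have hg := blowUpPullback_eq_mul_strictTransform hf q
    set g := strictTransform f q
    set i' := chartIndex q
    set j' := chartCoindex q
    set t := chartSlope q
    obtain ⟨p, hp, e⟩ := blowUpPullback_mem_of_mem_singularIdeal hq hg hmem
    have hX : (X i' : MvPolynomial (Fin 2) ℂ) ≠ 0 := X_ne_zero i'
    -- If the old coordinate pulls back to the new exceptional coordinate times a local unit,
    -- removing one exceptional factor turns exponent `N + 1` into `N`.
    suffices H : ∃ w, constantCoeff w ≠ 0 ∧ blowUpPullback i' j' t (X i) = X i' * w by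
      obtain ⟨w, hw, hi⟩ := H
      refine ih hq hm (c := C c') (by simpa using hc') hs'
        (u := w ^ (N + 1) * blowUpPullback i' j' t u) ?_ ?_
      · rw [map_mul, map_pow, constantCoeff_blowUpPullback hq]
        exact mul_ne_zero (pow_ne_zero _ hw) hu
      · rw [map_mul, map_pow, hi] at e
        convert hp using 1
        apply mul_left_cancel₀ hX
        linear_combination e
    rcases eq_or_eq_of_ne hq i with rfl | rfl
    · exact ⟨1, by simp, by simp⟩
    · obtain rfl : i' = j := by omega
      refine ⟨X j' + C t, ?_, blowUpPullback_X_right hq t⟩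
      -- If `t = 0`, the new point is the direction of the line `X i = 0`. The term `c * X j ^ 2`
      -- excludes this: the strict transform would take the nonzero value of `c` there.
      intro ht
      rw [map_add, constantCoeff_X, constantCoeff_C, zero_add] at ht
      rw [ht, hs, map_add, map_mul, map_mul, map_pow, blowUpPullback_X_left,
        blowUpPullback_X_right hq, map_zero, add_zero] at hg
      have e' : X j' * blowUpPullback i' j' 0 s = X i' * (g - blowUpPullback i' j' 0 c) := by
        apply mul_left_cancel₀ hX
        linear_combination hg
      obtain ⟨w, hw⟩ : X i' ∣ blowUpPullback i' j' 0 s := by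
        refine ((X_prime (R := ℂ) (i := i')).dvd_or_dvd ⟨_, e'⟩).resolve_left fun h => hq ?_
        exact X_dvd_X.1 h
      have hgc : g = blowUpPullback i' j' 0 c + X j' * w := by
        apply mul_left_cancel₀ hX
        rw [hw] at e'
        linear_combination -e'
      have h0 := ((two_le_multAtOrigin_iff g).1 hm.ge).1
      rw [hgc, map_add, map_mul, constantCoeff_X, zero_mul, add_zero,
        constantCoeff_blowUpPullback hq] at h0
      exact hc h0

/-! ### Discriminants of squarefree polynomials -/

/-- By Gauss's lemma `p` stays irreducible over the fraction field, hence coprime to `a` there; `d`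
clears the denominators of a Bézout identity. -/
lemma exists_C_mem_span_of_not_dvd {D : Type*} [CommRing D] [IsDomain D]
    [UniqueFactorizationMonoid D] {p a : Polynomial D} (hp : Irreducible p)
    (hdeg : p.natDegree ≠ 0) (ha : ¬ p ∣ a) :
    ∃ d : D, d ≠ 0 ∧ Polynomial.C d ∈ Ideal.span {p, a} := by
  classical
  obtain ⟨_⟩ : Nonempty (NormalizedGCDMonoid D) := inferInstance
  let K := FractionRing D
  have hprim : p.IsPrimitive := hp.isPrimitive hdeg
  have hpK : Irreducible (p.map (algebraMap D K)) :=
    (hprim.irreducible_iff_irreducible_map_fraction_map).1 hp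
  have haK : ¬ p.map (algebraMap D K) ∣ a.map (algebraMap D K) := fun h =>
    ha (hprim.dvd_of_fraction_map_dvd_fraction_map h)
  obtain ⟨u, v, huv⟩ := (hpK.coprime_iff_not_dvd).2 haK
  obtain ⟨b, hb, hu⟩ := IsLocalization.integerNormalization_spec (S := K) (nonZeroDivisors D) u
  obtain ⟨c, hc, hv⟩ := IsLocalization.integerNormalization_spec (S := K) (nonZeroDivisors D) v
  refine ⟨b * c, mul_ne_zero (nonZeroDivisors.ne_zero hb) (nonZeroDivisors.ne_zero hc),
    Ideal.mem_span_pair.2 ⟨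
      Polynomial.C c * IsLocalization.integerNormalization (nonZeroDivisors D) u,
      Polynomial.C b * IsLocalization.integerNormalization (nonZeroDivisors D) v, ?_⟩⟩
  apply Polynomial.map_injective _ (IsFractionRing.injective D K)
  rw [algebra_compatible_smul K, Polynomial.smul_eq_C_mul] at hu hv
  simp only [Polynomial.map_add, Polynomial.map_mul, Polynomial.map_C, hu, hv, map_mul]
  linear_combination Polynomial.C (algebraMap D K b) * Polynomial.C (algebraMap D K c) * huv

/-- A squarefree polynomial over a factorial domain of characteristic zero has nonzero
discriminant, in the sense that it and its derivative generate a nonzero constant. -/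
lemma Squarefree.exists_C_mem_span_derivative {D : Type*} [CommRing D] [IsDomain D]
    [UniqueFactorizationMonoid D] [CharZero D] {f : Polynomial D} (hf : Squarefree f) (h0 : f ≠ 0) :
    ∃ d : D, d ≠ 0 ∧ Polynomial.C d ∈ Ideal.span {f, Polynomial.derivative f} := by
  by_contra! H
  -- Otherwise a prime ideal avoiding nonzero constants contains `f` and its derivative, hence a
  -- prime factor `p` of `f`.
  let M := Submonoid.map (Polynomial.C : D →+* Polynomial D) (nonZeroDivisors D)
  obtain ⟨P, hP, hle, hdisj⟩ := Ideal.exists_le_prime_disjoint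
    (Ideal.span {f, Polynomial.derivative f}) M (by
      rw [Set.disjoint_right]
      rintro _ ⟨d, hd, rfl⟩ hmem
      exact H d (nonZeroDivisors.ne_zero hd) hmem)
  have hC : ∀ d : D, d ≠ 0 → Polynomial.C d ∉ P := fun d hd hmem =>
    Set.disjoint_right.1 hdisj ⟨d, mem_nonZeroDivisors_of_ne_zero hd, rfl⟩ hmem
  have hfP : f ∈ P := hle (Ideal.subset_span (by simp))
  have hfP' : Polynomial.derivative f ∈ P := hle (Ideal.subset_span (by simp))
  obtain ⟨p, hp, hpf, hpP⟩ : ∃ p, Prime p ∧ p ∣ f ∧ p ∈ P := by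
    obtain ⟨s, hs, hsf⟩ := UniqueFactorizationMonoid.exists_prime_factors f h0
    have hprod : s.prod ∈ P := P.mem_of_dvd hsf.symm.dvd hfP
    obtain ⟨p, hps, hpP⟩ := (Ideal.IsPrime.multiset_prod_mem_iff_exists_mem hP s).1 hprod
    exact ⟨p, hs p hps, (Multiset.dvd_prod hps).trans hsf.dvd, hpP⟩
  obtain ⟨g, rfl⟩ := hpf
  have hdeg : p.natDegree ≠ 0 := by
    intro h
    rw [Polynomial.eq_C_of_natDegree_eq_zero h] at hpP hp
    exact hC _ (fun h' => hp.ne_zero (by rw [h', map_zero])) hpP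
  -- Degree rules out `p` dividing its nonzero derivative, and squarefreeness rules out `p` dividing
  -- `g`.
  have hndvd : ¬ p ∣ Polynomial.derivative p * g := by
    intro h
    rcases hp.dvd_or_dvd h with h | ⟨g', rfl⟩
    · have h1 : Polynomial.derivative p ≠ 0 := fun h' =>
        hdeg (Polynomial.derivative_eq_zero.1 h')
      exact absurd (Polynomial.degree_le_of_dvd h h1)
        (not_le.2 (Polynomial.degree_derivative_lt hp.ne_zero))
    · exact hp.not_isUnit (hf p ⟨g', by ring⟩)
  obtain ⟨d, hd, hmem⟩ := exists_C_mem_span_of_not_dvd hp.irreducible hdeg hndvd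
  refine hC d hd (Ideal.span_le.2 ?_ hmem)
  rintro _ (rfl | rfl)
  · exact hpP
  · rw [Polynomial.derivative_mul] at hfP'
    exact (P.add_mem_iff_left (P.mul_mem_right _ hpP)).1 hfP'

lemma Squarefree.map_mulEquiv {A B : Type*} [CommMonoid A] [CommMonoid B] (φ : A ≃* B) {x : A}
    (hx : Squarefree x) : Squarefree (φ x) := by
  intro y hy
  have h := map_dvd φ.symm hy
  rw [map_mul, MulEquiv.symm_apply_apply] at h
  simpa using (hx _ h)

/-- Bivariate polynomials as polynomials in `X j` over the polynomials in `X i`. -/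
noncomputable def toPolynomialPolynomial {i j : Fin 2} (hij : i ≠ j) :
    MvPolynomial (Fin 2) ℂ ≃ₐ[ℂ] Polynomial (Polynomial ℂ) :=
  AlgEquiv.ofAlgHom (pairEval i (Polynomial.C Polynomial.X) Polynomial.X)
    (Polynomial.eval₂AlgHom (Polynomial.aeval (X i)) (X j) fun _ => Commute.all _ _)
    (by ext <;> simp [pairEval_X_of_ne hij])
    (algHom_ext_of_ne hij (by simp) (by simp [pairEval_X_of_ne hij]))

lemma toPolynomialPolynomial_symm_C {i j : Fin 2} (hij : i ≠ j) (p : Polynomial ℂ) :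
    (toPolynomialPolynomial hij).symm (Polynomial.C p) = Polynomial.aeval (X i) p := by
  simp [toPolynomialPolynomial]

lemma toPolynomialPolynomial_pderiv {i j : Fin 2} (hij : i ≠ j) (f : MvPolynomial (Fin 2) ℂ) :
    toPolynomialPolynomial hij (pderiv j f) =
      Polynomial.derivative (toPolynomialPolynomial hij f) := by
  change pairEval i (Polynomial.C (Polynomial.X (R := ℂ))) Polynomial.X _ =
    Polynomial.derivative (pairEval i (Polynomial.C (Polynomial.X (R := ℂ))) Polynomial.X f)
  induction f using MvPolynomial.induction_on with
  | C a => simp [← algebraMap_eq, Polynomial.algebraMap_apply]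
  | add f g hf hg => simp only [map_add, hf, hg]
  | mul_X f l hf =>
    rcases eq_or_eq_of_ne hij l with rfl | rfl
    · rw [Derivation.leibniz, pderiv_X_of_ne hij]
      simp [hf]
      ring
    · rw [Derivation.leibniz, pderiv_X_self]
      simp [pairEval_X_of_ne hij, hf]
      ring

/-- Eliminating `X j` gives a nonzero polynomial in `X i` alone; `N` is its order of vanishing at
zero. -/
lemma Squarefree.exists_pow_mul_mem_singularIdeal {f : MvPolynomial (Fin 2) ℂ}
    (hf : Squarefree f) (h0 : f ≠ 0) {i j : Fin 2} (hij : i ≠ j) :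
    ∃ N u, constantCoeff u ≠ 0 ∧ X i ^ N * u ∈ singularIdeal f := by
  let Φ := toPolynomialPolynomial hij
  obtain ⟨d, hd, hmem⟩ := (hf.map_mulEquiv Φ.toMulEquiv).exists_C_mem_span_derivative
    ((map_ne_zero_iff Φ Φ.injective).2 h0)
  obtain ⟨a, b, hab⟩ := Ideal.mem_span_pair.1 hmem
  obtain ⟨q, hq, hXq⟩ := Polynomial.exists_eq_pow_rootMultiplicity_mul_and_not_dvd d hd 0
  rw [map_zero, sub_zero] at hq hXq
  refine ⟨d.rootMultiplicity 0, Polynomial.aeval (X i) q, ?_, ?_⟩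
  · intro h
    refine hXq (Polynomial.X_dvd_iff.2 ?_)
    rw [← h, ← coeff_zero_pairEval i Polynomial.coeff_X_zero Polynomial.coeff_X_zero,
      pairEval_X_aeval, Polynomial.aeval_X_left_apply]
  · have e : Φ.symm (Polynomial.C d) = Φ.symm a * f + Φ.symm b * pderiv j f := by
      rw [← hab, map_add, map_mul, map_mul]
      change _ * Φ.symm (Φ f) + _ * Φ.symm (Polynomial.derivative (Φ f)) = _
      rw [← toPolynomialPolynomial_pderiv hij, AlgEquiv.symm_apply_apply,
        AlgEquiv.symm_apply_apply]
    rw [toPolynomialPolynomial_symm_C, hq, map_mul, map_pow, Polynomial.aeval_X] at e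
    rw [e]
    exact Ideal.add_mem _ (Ideal.mul_mem_left _ _ (self_mem_singularIdeal f))
      (Ideal.mul_mem_left _ _ (pderiv_mem_singularIdeal f j))

/-- Reduced double points are resolved by finitely many blow-ups. -/
lemma contactDeterminesResolution_of_squarefree {f : MvPolynomial (Fin 2) ℂ} (hsf : Squarefree f)
    (hf : multAtOrigin f = 2) : ContactDeterminesResolution f := by
  have h0 : f ≠ 0 := by
    rintro rfl
    simp [multAtOrigin] at hf
  rcases contactDeterminesResolution_or_reduction hf with h | ⟨q, c, s, hc, -, hs, -⟩
  · exact h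
  have hij := chartIndex_ne_chartCoindex q
  have hg := blowUpPullback_eq_mul_strictTransform hf q
  obtain ⟨a, b, d, habd⟩ := exists_quadratic_of_mult_two hij hf
  -- Comparing the `X j ^ 2` coefficients on the exceptional line identifies `c` with the constant
  -- term of `d`, so `X i = 0` is not tangent to `f`.
  have hd : constantCoeff d ≠ 0 := by
    rw [hs, habd] at hg
    obtain ⟨s', hs'⟩ := strictTransform_expansion hij hg
    have h2 := congrArg
      (fun g => (pairEval (chartIndex q) (0 : Polynomial ℂ) Polynomial.X g).coeff 2) hs'
    have ht : (Polynomial.C (chartSlope q) ^ 2).coeff 2 = 0 := by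
      rw [← Polynomial.C_pow, Polynomial.coeff_C_succ]
    have hcd : c = constantCoeff d := by
      simpa [pairEval_X_of_ne hij, ← algebraMap_eq, Polynomial.coeff_X, ht] using h2
    rwa [← hcd]
  obtain ⟨N, u, hu, hmem⟩ := hsf.exists_pow_mul_mem_singularIdeal h0 hij
  refine contactDeterminesResolution_of_pow_mem N hij hf (c := d)
    (s := X (chartIndex q) * a + X (chartCoindex q) * b) hd ?_ hu hmem
  linear_combination habd

/-! ### Squarefreeness of the local equation -/

lemma totalDegree_aeval_le_of_forall_le_one {σ τ R : Type*} [CommRing R]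
    {g : σ → MvPolynomial τ R} (hg : ∀ i, (g i).totalDegree ≤ 1) (p : MvPolynomial σ R) :
    (aeval g p).totalDegree ≤ p.totalDegree := by
  rw [aeval_def, eval₂_eq]
  refine totalDegree_finsetSum_le fun m hm => ?_
  refine (totalDegree_mul _ _).trans ?_
  rw [algebraMap_eq, totalDegree_C, zero_add]
  refine (totalDegree_finsetProd _ _).trans (le_trans ?_ (le_totalDegree hm))
  refine Finset.sum_le_sum fun i _ => (totalDegree_pow _ _).trans ?_
  calc m i * (g i).totalDegree ≤ m i * 1 := Nat.mul_le_mul_left _ (hg i)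
    _ = m i := mul_one _

/-- Restriction of ternary polynomials to the affine chart `z = 1`. -/
noncomputable def dehomogenize : MvPolynomial (Fin 3) ℂ →ₐ[ℂ] MvPolynomial (Fin 2) ℂ :=
  aeval ![X 0, X 1, 1]

/-- The affine coordinates `x / z`, `y / z` as rational functions of `x`, `y`, `z`. -/
noncomputable def affineCoordinates :
    MvPolynomial (Fin 2) ℂ →ₐ[ℂ] FractionRing (MvPolynomial (Fin 3) ℂ) :=
  aeval fun i => algebraMap _ _ (X i.castSucc : MvPolynomial (Fin 3) ℂ) /
    algebraMap _ _ (X 2 : MvPolynomial (Fin 3) ℂ)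

lemma algebraMap_X_two_ne_zero :
    algebraMap _ (FractionRing (MvPolynomial (Fin 3) ℂ)) (X 2 : MvPolynomial (Fin 3) ℂ) ≠ 0 :=
  (map_ne_zero_iff _ (IsFractionRing.injective _ _)).2 (X_ne_zero 2)

/-- Any `a` at least the degree is allowed, so that surplus powers of `X 2` can be absorbed. -/
lemma exists_homogenization (p : MvPolynomial (Fin 2) ℂ) {a : ℕ} (ha : p.totalDegree ≤ a) :
    ∃ P : MvPolynomial (Fin 3) ℂ, dehomogenize P = p ∧
      algebraMap _ (FractionRing (MvPolynomial (Fin 3) ℂ)) P =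
        algebraMap _ (FractionRing (MvPolynomial (Fin 3) ℂ)) (X 2 : MvPolynomial (Fin 3) ℂ) ^ a *
          affineCoordinates p := by
  refine ⟨∑ m ∈ p.support, C (coeff m p) * (X 0 ^ m 0 * X 1 ^ m 1 * X 2 ^ (a - (m 0 + m 1))),
    ?_, ?_⟩
  · rw [map_sum]
    conv_rhs => rw [p.as_sum]
    refine Finset.sum_congr rfl fun m _ => ?_
    rw [monomial_eq, Finsupp.prod_fintype _ _ (by simp), Fin.prod_univ_two]
    simp [dehomogenize, ← algebraMap_eq]
  · rw [map_sum, affineCoordinates, aeval_def, eval₂_eq', Finset.mul_sum]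
    refine Finset.sum_congr rfl fun m hm => ?_
    have hle : m 0 + m 1 ≤ a := by
      refine le_trans ?_ ((le_totalDegree hm).trans ha)
      rw [Finsupp.sum_fintype _ _ (by simp), Fin.sum_univ_two]
    obtain ⟨k, rfl⟩ := Nat.exists_eq_add_of_le hle
    have hz := algebraMap_X_two_ne_zero
    rw [Fin.prod_univ_two, add_tsub_cancel_left, map_mul, map_mul, map_mul, map_pow, map_pow,
      map_pow, ← algebraMap_eq, ← IsScalarTower.algebraMap_apply]
    simp only [Fin.castSucc_zero, Fin.castSucc_one, div_pow, pow_add]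
    field_simp

lemma algebraMap_eq_pow_mul_affineCoordinates {G : MvPolynomial (Fin 3) ℂ} {n : ℕ}
    (hG : G.IsHomogeneous n) :
    algebraMap _ (FractionRing (MvPolynomial (Fin 3) ℂ)) G =
      algebraMap _ (FractionRing (MvPolynomial (Fin 3) ℂ)) (X 2 : MvPolynomial (Fin 3) ℂ) ^ n *
        affineCoordinates (dehomogenize G) := by
  have hz := algebraMap_X_two_ne_zero
  have hcomp : affineCoordinates.comp dehomogenize =
      aeval fun i => algebraMap _ (FractionRing (MvPolynomial (Fin 3) ℂ))
        (X i : MvPolynomial (Fin 3) ℂ) / algebraMap _ _ (X 2 : MvPolynomial (Fin 3) ℂ) := by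
    ext i
    fin_cases i <;> simp [affineCoordinates, dehomogenize, hz]
  rw [← AlgHom.comp_apply, hcomp, aeval_def, eval₂_eq', Finset.mul_sum]
  conv_lhs => rw [G.as_sum, map_sum]
  refine Finset.sum_congr rfl fun m hm => ?_
  have hdeg : ∑ i, m i = n := by
    rw [← Finsupp.degree_eq_sum]
    by_contra h
    exact (mem_support_iff.1 hm) (hG.coeff_eq_zero h)
  rw [monomial_eq, Finsupp.prod_fintype _ _ (by simp), ← hdeg]
  simp only [div_pow, Finset.prod_div_distrib, Finset.prod_pow_eq_pow_sum, map_mul, map_prod,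
    map_pow]
  rw [← algebraMap_eq, ← IsScalarTower.algebraMap_apply]
  field_simp

lemma squarefree_dehomogenize {G : MvPolynomial (Fin 3) ℂ} {n : ℕ} (hG : G.IsHomogeneous n)
    (hsf : Squarefree G) (h0 : dehomogenize G ≠ 0) : Squarefree (dehomogenize G) := by
  rintro p ⟨q, hq⟩
  have hp0 : p ≠ 0 := by rintro rfl; simp [hq] at h0
  have hq0 : q ≠ 0 := by rintro rfl; simp [hq] at h0
  have hdeg : p.totalDegree + p.totalDegree + q.totalDegree ≤ n := by
    rw [← totalDegree_mul_of_isDomain hp0 hp0, ← totalDegree_mul_of_isDomain (mul_ne_zero hp0 hp0)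
      hq0, ← hq]
    refine (totalDegree_aeval_le_of_forall_le_one (fun i => ?_) G).trans hG.totalDegree_le
    fin_cases i <;> simp
  obtain ⟨k, hk⟩ := Nat.exists_eq_add_of_le hdeg
  obtain ⟨P, hP, hP'⟩ := exists_homogenization p le_rfl
  -- The surplus degree `k` goes into `Q`, so that a square factor of the dehomogenization lifts to
  -- one of `G`.
  obtain ⟨Q, hQ, hQ'⟩ := exists_homogenization q (Nat.le_add_right _ k)
  have hfac : G = P * P * Q := by
    apply IsFractionRing.injective (MvPolynomial (Fin 3) ℂ) (FractionRing (MvPolynomial (Fin 3) ℂ))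
    rw [map_mul, map_mul, hP', hQ', algebraMap_eq_pow_mul_affineCoordinates hG, hq, hk]
    simp only [map_mul]
    ring
  rw [← hP]
  exact (hsf P ⟨Q, hfac⟩).map dehomogenize

/-- The linear change of homogeneous coordinates attached to a basis of `ℂ³`. -/
noncomputable def linearSubstitution (M : Matrix (Fin 3) (Fin 3) ℂ) :
    MvPolynomial (Fin 3) ℂ →ₐ[ℂ] MvPolynomial (Fin 3) ℂ :=
  aeval fun i => ∑ k, C (M k i) * X k

lemma linearSubstitution_comp (M N : Matrix (Fin 3) (Fin 3) ℂ) :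
    (linearSubstitution M).comp (linearSubstitution N) = linearSubstitution (M * N) := by
  ext1 i
  simp only [linearSubstitution, AlgHom.comp_apply, aeval_X, map_sum, map_mul, Matrix.mul_apply,
    algHom_C, algebraMap_eq, Finset.mul_sum, Finset.sum_mul]
  rw [Finset.sum_comm]
  exact Finset.sum_congr rfl fun _ _ => Finset.sum_congr rfl fun _ _ => by ring

lemma linearSubstitution_one : linearSubstitution 1 = AlgHom.id ℂ _ := by
  ext1 i
  simp [linearSubstitution, Matrix.one_apply]

lemma squarefree_localEquation {F : MvPolynomial (Fin 3) ℂ} {n : ℕ} (hF : F.IsHomogeneous n)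
    (hsf : Squarefree F) (e : Module.Basis (Fin 3) ℂ (Fin 3 → ℂ)) (h0 : localEquation F e ≠ 0) :
    Squarefree (localEquation F e) := by
  let M : Matrix (Fin 3) (Fin 3) ℂ := Matrix.of fun k i => e k i
  have hM : IsUnit M.det := by
    have h := (Pi.basisFun ℂ (Fin 3)).isUnit_det e
    rw [Module.Basis.det_apply, ← Matrix.det_transpose] at h
    convert h using 2
    ext k i
    simp [M, Module.Basis.toMatrix_apply]
  have hloc : localEquation F e = dehomogenize (linearSubstitution M F) := by
    have : (aeval fun i : Fin 3 => C (e 0 i) * X 0 + C (e 1 i) * X 1 + C (e 2 i) :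
        MvPolynomial (Fin 3) ℂ →ₐ[ℂ] MvPolynomial (Fin 2) ℂ) =
        dehomogenize.comp (linearSubstitution M) := by
      ext1 i
      simp [dehomogenize, linearSubstitution, M, Fin.sum_univ_three, ← algebraMap_eq]
    exact DFunLike.congr_fun this F
  let φ : MvPolynomial (Fin 3) ℂ ≃ₐ[ℂ] MvPolynomial (Fin 3) ℂ :=
    AlgEquiv.ofAlgHom (linearSubstitution M) (linearSubstitution M⁻¹)
      (by rw [linearSubstitution_comp, Matrix.mul_nonsing_inv _ hM, linearSubstitution_one])
      (by rw [linearSubstitution_comp, Matrix.nonsing_inv_mul _ hM, linearSubstitution_one])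
  have hhom : (linearSubstitution M F).IsHomogeneous n := by
    have := hF.aeval (fun i => ∑ k, C (M k i) * X k)
      fun i => IsHomogeneous.sum _ _ 1 fun k _ => isHomogeneous_C_mul_X _ k
    rwa [one_mul] at this
  rw [hloc] at h0 ⊢
  exact squarefree_dehomogenize hhom (hsf.map_mulEquiv φ.toMulEquiv) h0

theorem theorem2p3
    (n : ℕ) (F : MvPolynomial (Fin 3) ℂ) (hF : F.IsHomogeneous n) (hred : Squarefree F)
    (P : Projectivization ℂ (Fin 3 → ℂ))
    (e : Module.Basis (Fin 3) ℂ (Fin 3 → ℂ))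
    (he : Projectivization.mk ℂ (e 2) (e.ne_zero 2) = P)
    (hP : multAtOrigin (localEquation F e) = 2) :
    (∀ r : ℕ, 1 ≤ r →
      ((∀ ℓ : ℕ, 2 * r + 1 < ℓ → ¬ ContainsCurvilinear (localEquation F e) ℓ) ↔
        ∃ s : ℕ, 1 ≤ s ∧ s ≤ r ∧ IsTypeA (localEquation F e) (2 * s))) ∧
    ((∃ r : ℕ, 1 ≤ r ∧ IsTypeA (localEquation F e) (2 * r - 1)) ↔
      ∀ ℓ : ℕ, 1 ≤ ℓ → ContainsCurvilinear (localEquation F e) ℓ) ∧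
    (∀ r : ℕ, 1 ≤ r →
      (IsTypeA (localEquation F e) (2 * r) ↔
        (∀ ℓ : ℕ, 1 ≤ ℓ → ℓ ≤ 2 * r + 1 → ContainsCurvilinear (localEquation F e) ℓ) ∧
        (∀ ℓ : ℕ, 2 * r + 1 < ℓ → ¬ ContainsCurvilinear (localEquation F e) ℓ))) := by
  set f := localEquation F e
  have h0 : f ≠ 0 := by
    intro h
    rw [h] at hP
    simp [multAtOrigin] at hP
  obtain ⟨r₀, hr₀, H⟩ :=
    contactDeterminesResolution_of_squarefree (squarefree_localEquation hF hred e h0) hP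
  have hcurv : ∀ ℓ, 1 ≤ ℓ → (ContainsCurvilinear f ℓ ↔ ∃ i, HasGraph i f ℓ) := fun ℓ hℓ =>
    containsCurvilinear_iff hℓ
  have heven : ∀ s, IsTypeA f (2 * s) ↔ ResolvedBy f s 1 := by
    intro s
    constructor
    · rintro ⟨-, r, ε, hε, hs, hR⟩
      obtain rfl : ε = 0 := by omega
      obtain rfl : s = r := by omega
      exact hR
    · exact fun hR => ⟨hP, s, 0, by omega, by omega, hR⟩
  -- Since `1 ≤ r`, the subtraction is not truncated and `2 * r - 1` is odd, which forces `ε = 1`.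
  have hodd : ∀ r, 1 ≤ r → (IsTypeA f (2 * r - 1) ↔ ResolvedBy f r 2) := by
    intro r hr
    constructor
    · rintro ⟨-, r', ε, hε, hs, hR⟩
      obtain rfl : ε = 1 := by omega
      obtain rfl : r = r' := by omega
      exact hR
    · exact fun hR => ⟨hP, r, 1, le_rfl, by omega, hR⟩
  simp only [heven]
  rcases H with ⟨hR, hall⟩ | ⟨hR, hbound⟩
  · have hcontains : ∀ ℓ, 1 ≤ ℓ → ContainsCurvilinear f ℓ := fun ℓ hℓ =>
      (hcurv ℓ hℓ).2 (hall ℓ)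
    refine ⟨fun r _ => iff_of_false (fun h => ?_) ?_, iff_of_true ?_ hcontains,
      fun r _ => iff_of_false ?_ fun h => ?_⟩
    · exact h (2 * r + 2) (by omega) (hcontains _ (by omega))
    · rintro ⟨s, -, -, hs⟩
      have := ((hR _ _).1 hs).2
      omega
    · exact ⟨r₀, hr₀, (hodd r₀ hr₀).2 ((hR _ _).2 ⟨rfl, rfl⟩)⟩
    · intro hs
      have := ((hR _ _).1 hs).2
      omega
    · exact h.2 (2 * r + 2) (by omega) (hcontains _ (by omega))
  · have hcontains : ∀ ℓ, 1 ≤ ℓ → (ContainsCurvilinear f ℓ ↔ ℓ ≤ 2 * r₀ + 1) := fun ℓ hℓ =>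
      (hcurv ℓ hℓ).trans (hbound ℓ)
    have htop := (hcontains (2 * r₀ + 1) (by omega)).2 le_rfl
    have hnot : ∀ r, r₀ ≤ r → ∀ ℓ, 2 * r + 1 < ℓ → ¬ ContainsCurvilinear f ℓ := by
      intro r hr ℓ hℓ h
      have := (hcontains ℓ (by omega)).1 h
      omega
    have hge : ∀ r, (∀ ℓ, 2 * r + 1 < ℓ → ¬ ContainsCurvilinear f ℓ) → r₀ ≤ r := by
      intro r h
      by_contra! hlt
      exact h _ (by omega) htop
    refine ⟨fun r _ => ⟨fun h => ?_, ?_⟩, iff_of_false ?_ fun h => ?_,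
      fun r _ => ⟨fun hs => ?_, fun h => ?_⟩⟩
    · exact ⟨r₀, hr₀, hge r h, (hR _ _).2 ⟨rfl, rfl⟩⟩
    · rintro ⟨s, -, hsr, hs⟩
      obtain rfl := ((hR _ _).1 hs).1
      exact hnot r hsr
    · rintro ⟨r, hr, hs⟩
      have := ((hR _ _).1 ((hodd r hr).1 hs)).2
      omega
    · have := (hcontains (2 * r₀ + 2) (by omega)).1 (h _ (by omega))
      omega
    · obtain rfl := ((hR _ _).1 hs).1
      exact ⟨fun ℓ h1 h2 => (hcontains ℓ h1).2 h2, hnot r le_rfl⟩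
    · have h1 := hge r h.2
      have h2 := (hcontains (2 * r + 1) (by omega)).1 (h.1 _ (by omega) le_rfl)
      exact (hR _ _).2 ⟨by omega, rfl⟩
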